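/- **Definitions.** For $k\ge 0$ let $\mathsf{MCX}_k|x_0,\dots,x_{k-1},t\rangle=|x_0,\dots,x_{k-1},t\oplus\prod_{i<k} x_i\rangle$, $\mathsf{CNOT}=\mathsf{MCX}_1$, $\mathrm{Toffoli}=\mathsf{MCX}_2$ (controls first, target last). For $m\ge 0$ let - $\mathsf{L}_1^{(m)}$ be the operator on $m+1$ qubits $|x_0,\dots,x_m\rangle\mapsto|x_0\rangle\bigotimes_{i=1}^m|x_i\oplus x_{i-1}\rangle$; - $\mathsf{L}_2^{(m)}$ be the operator on $2m+1$ qubits $|x_0,\dots,x_{2m}\rangle\mapsto|x_0\rangle\bigotimes_{i=1}^m|x_{2i-1}\rangle|x_{2i}\oplus x_{2i-2}x_{2i-1}\rangle$; - $\mathsf{F}_1^{(m)}$ (Fan-out$_1$) be the operator $|c\rangle\bigotimes_{i<m}|x_i\rangle\mapsto|c\rangle\bigotimes_{i<m}|x_i\oplus c\rangle$; - $\mathsf{F}_2^{(m)}$ (Fan-out$_2$) be the operator $|c\rangle\bigotimes_{i<m}|x_i\rangle|y_i\rangle\mapsto|c\rangle\bigotimes_{i<m}|x_i\rangle|y_i\oplus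 c\,x_i\rangle$. **The controlled adder.** Let $n\ge 2$. On the $2n+2$ qubits $C$, $A=(A_0,\dots,A_{n-1})$, $B=(B_0,\dots,B_{n-1})$, $Z$ (index $0$ is the least significant bit), apply successively: 1. $\mathsf{CNOT}(A_i,B_i)$ for $i=1,\dots,n-1$; 2. $\mathrm{Toffoli}(C,A_{n-1},Z)$, then $\mathsf{L}_1^{(n-2)}$ on $(A_1,\dots,A_{n-1})$; 3. $(\mathsf{L}_2^{(n-1)})^\dagger$ on $(A_0,B_0,\dots,A_{n-2},B_{n-2},A_{n-1})$, then $\mathsf{MCX}_3(C,A_{n-1},B_{n-1},Z)$; 4. $\mathsf{F}_2^{(n-1)}$ on $(C,A_1,B_1,\dots,A_{n-1},B_{n-1})$; 5. $\mathsf{F}_1^{(n-2)}$ on $(C,B_1,\dots,B_{n-2})$, then $\mathsf{L}_2^{(n-1)}$ on $(A_0,B_0,\dots,A_{n-2},B_{n-2},A_{n-1})$, then $\mathsf{F}_1^{(n-2)}$ on $(C,B_1,\dots,B_{n-2})$; 6. $(\mathsf{L}_1^{(n-2)})^\dagger$ on $(A_1,\dots,A_{n-1})$; 7. $\mathrm{Toffoli}(C,A_0,B_0)$,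 then $\mathsf{CNOT}(A_i,B_i)$ for $i=1,\dots,n-1$. (So the operators that are later uncomputed, namely the $\mathsf{CNOT}$s, $\mathsf L_1$ and $\mathsf L_2$, are not controlled by $C$; only the Toffoli and $\mathsf{MCX}_3$ gates and the $\mathsf F_1$, $\mathsf F_2$ operators involve $C$.) **Theorem.** For every $n\ge 2$ this sequence of operators implements addition controlled by $c$: for all $c,z\in\{0,1\}$ and all integers $0\le a,b<2^n$, $$|c\rangle_C|a\rangle_A|b\rangle_B|z\rangle_Z\longmapsto|c\rangle_C|a\rangle_A|ca+b \bmod 2^n\rangle_B|z\oplus c\,(a+b)_n\rangle_Z,$$ where $(a+b)_n$ is the bit of weight $2^n$ of $a+b$. Moreover it can be constructed over the gate set $\{\mathrm{Toffoli},\mathsf{CNOT}\}$ with depth $O(\log^2 n)$ and $O(n\log n)$ gates, without ancilla qubits: there is a constant $K$ such that for every $n\ge2$ each operator in the sequence can be replaced by a circuit of Toffoli and $\mathsf{CNOT}$ gates on the same $2n+2$ qubits that implements this operator, in such a way that the resulting circuit (which implements the same operator as the sequence) has depth at most $K\log_2^2 n$ and at most $K\,n\log_2 n$ gates. Here depth is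 the number of time steps when gates acting on disjoint sets of qubits may be performed simultaneously. -/

import Mathlib

/-! ### Pure states, operators, and operators applied to chosen qubits -/

/-- The state space `(ℂ²)^{⊗ Q}` of a set `Q` of qubits, with orthonormal computational basis
indexed by the bit assignments `Q → Bool`. -/
abbrev QState (Q : Type) [Fintype Q] [DecidableEq Q] : Type :=
  EuclideanSpace ℂ (Q → Bool)

/-- Linear operators on the state space of the qubits `Q`. -/
abbrev QOp (Q : Type) [Fintype Q] [DecidableEq Q] : Type :=
  QState Q →ₗ[ℂ] QState Q

/-- The computational basis state `|x⟩`. -/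
noncomputable def ket {Q : Type} [Fintype Q] [DecidableEq Q] (x : Q → Bool) : QState Q :=
  EuclideanSpace.single x 1

/-- The linear operator with prescribed images `|x⟩ ↦ v x` of the basis states. -/
noncomputable def linearExt {Q : Type} [Fintype Q] [DecidableEq Q]
    (v : (Q → Bool) → QState Q) : QOp Q :=
  (EuclideanSpace.basisFun (Q → Bool) ℂ).toBasis.constr ℂ v

/-- The linear operator `|x⟩ ↦ |f x⟩`. -/
noncomputable def basisOp {Q : Type} [Fintype Q] [DecidableEq Q]
    (f : (Q → Bool) → (Q → Bool)) : QOp Q :=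
  linearExt fun x => ket (f x)

/-- The `m`-qubit operator `U` applied on the qubits `(w 0, …, w (m-1))` of `Q`, tensored with the
identity on the other qubits:
`|x⟩ ↦ ∑ y, ⟨y|U|x_{w 0}, …, x_{w (m-1)}⟩ |x with the bits at w 0, …, w (m-1) replaced by y⟩`. -/
noncomputable def applyOn {Q : Type} [Fintype Q] [DecidableEq Q] {m : ℕ}
    (w : Fin m ↪ Q) (U : QOp (Fin m)) : QOp Q :=
  linearExt fun x =>
    ∑ y : Fin m → Bool, (U (ket (x ∘ w))) y • ket (Function.extend w y x)

/-! ### The multi-controlled X gate, the ladders and the fan-out operators -/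

/-- `MCX_k |x_0, …, x_{k-1}, t⟩ = |x_0, …, x_{k-1}, t ⊕ ∏ x_i⟩`. -/
noncomputable def MCX (k : ℕ) : QOp (Fin (k + 1)) :=
  basisOp fun x i =>
    if i = Fin.last k then xor (x i) (decide (∀ j : Fin k, x j.castSucc = true)) else x i

/-- `CNOT = MCX_1`. -/
noncomputable def CNOT : QOp (Fin 2) := MCX 1

/-- `Toffoli = MCX_2`. -/
noncomputable def Toffoli : QOp (Fin 3) := MCX 2

/-- `L_1^{(m)}`: on `m + 1` qubits, `x_0` is kept and `x_i` becomes `x_i ⊕ x_{i-1}` for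
`1 ≤ i ≤ m` (with the initial values on the right). -/
noncomputable def ladder1 (m : ℕ) : QOp (Fin (m + 1)) :=
  basisOp fun x i => Fin.cases (x 0) (fun j : Fin m => xor (x j.succ) (x j.castSucc)) i

/-- `L_2^{(m)}`: on `2m + 1` qubits, `x_{2i}` becomes `x_{2i} ⊕ x_{2i-2} x_{2i-1}` for
`1 ≤ i ≤ m` (with the initial values on the right), and the other bits are kept. -/
noncomputable def ladder2 (m : ℕ) : QOp (Fin (2 * m + 1)) :=
  basisOp fun x i =>
    if 2 ≤ i.val ∧ i.val % 2 = 0 then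
      xor (x i) (x ⟨i.val - 2, by omega⟩ && x ⟨i.val - 1, by omega⟩)
    else x i

/-- `F_1^{(m)} |c⟩|x_0, …, x_{m-1}⟩ = |c⟩|x_0 ⊕ c, …, x_{m-1} ⊕ c⟩`. -/
noncomputable def fanOut1 (m : ℕ) : QOp (Fin (m + 1)) :=
  basisOp fun x i => Fin.cases (x 0) (fun j : Fin m => xor (x j.succ) (x 0)) i

/-- `F_2^{(m)} |c⟩ ⨂ |x_i⟩|y_i⟩ = |c⟩ ⨂ |x_i⟩|y_i ⊕ c x_i⟩`; `c` is qubit `0`, `x_i` is qubit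
`2i + 1` and `y_i` is qubit `2i + 2`. -/
noncomputable def fanOut2 (m : ℕ) : QOp (Fin (2 * m + 1)) :=
  basisOp fun x i =>
    if 2 ≤ i.val ∧ i.val % 2 = 0 then
      xor (x i) (x 0 && x ⟨i.val - 1, by omega⟩)
    else x i

/-! ### Programs: sequences of operators applied on chosen qubits -/

/-- The instruction "apply `op` on the (distinct) qubits `wires 0, …, wires (arity - 1)`". -/
structure Instruction (Q : Type) where
  arity : ℕ
  wires : Fin arity ↪ Q
  op : QOp (Fin arity)

/-- The operator of an instruction on the whole register. -/
noncomputable def Instruction.toOp {Q : Type} [Fintype Q] [DecidableEq Q]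
    (s : Instruction Q) : QOp Q :=
  applyOn s.wires s.op

/-- The operator of a sequence of instructions; the head of the list is applied first. -/
noncomputable def programOp {Q : Type} [Fintype Q] [DecidableEq Q] :
    List (Instruction Q) → QOp Q
  | [] => LinearMap.id
  | s :: l => programOp l ∘ₗ s.toOp

/-! ### Circuits over the gate set {Toffoli, CNOT}, gate count and depth -/

/-- A CNOT or Toffoli gate with its distinct qubits (controls first, target last). -/
inductive Gate (Q : Type) : Type
  | cnot (w : Fin 2 ↪ Q) : Gate Q
  | toffoli (w : Fin 3 ↪ Q) : Gate Q

/-- The instruction carried out by a gate. -/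
noncomputable def Gate.toInstruction {Q : Type} : Gate Q → Instruction Q
  | .cnot w => ⟨2, w, CNOT⟩
  | .toffoli w => ⟨3, w, Toffoli⟩

/-- The qubits on which a gate acts. -/
def Gate.support {Q : Type} : Gate Q → Finset Q
  | .cnot w => Finset.univ.map w
  | .toffoli w => Finset.univ.map w

/-- A {Toffoli, CNOT} circuit on the qubits `Q`: its gates in order of application. The gate count
is the length of the list. All qubits of the circuit are in `Q`. -/
abbrev Circuit (Q : Type) : Type := List (Gate Q)

/-- The operator of a circuit. -/
noncomputable def Circuit.toOp {Q : Type} [Fintype Q] [DecidableEq Q] (G : Circuit Q) : QOp Q :=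
  programOp (G.map Gate.toInstruction)

/-- One step of the as-soon-as-possible schedule: `t q` is the number of the last time step in
which qubit `q` has been used; gate `g` is put in the first time step after those of all qubits
on which it acts. -/
def Gate.schedule {Q : Type} [DecidableEq Q] (t : Q → ℕ) (g : Gate Q) : Q → ℕ :=
  fun q => if q ∈ g.support then g.support.sup t + 1 else t q

/-- The depth of a circuit: the number of time steps of its as-soon-as-possible schedule, in which
gates acting on disjoint sets of qubits may share a time step; equivalently, the length of a
longest chain of successive gates each of which shares a qubit with the next. -/
def Circuit.depth {Q : Type} [Fintype Q] [DecidableEq Q] (G : Circuit Q) : ℕ :=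
  Finset.univ.sup (G.foldl Gate.schedule fun _ => 0)

/-! ### The controlled adder -/

/-- The `2n + 2` qubits of the controlled adder: the control `C`, the registers `A_0, …, A_{n-1}`
and `B_0, …, B_{n-1}` (index `0` is the least significant bit), and `Z`. -/
inductive Qubit (n : ℕ) : Type
  | C : Qubit n
  | A (i : Fin n) : Qubit n
  | B (i : Fin n) : Qubit n
  | Z : Qubit n
  deriving DecidableEq, Fintype

/-- The bits of the basis state `|c⟩_C |a⟩_A |b⟩_B |z⟩_Z`, the integers `a, b < 2^n` being written
in binary. -/
def registerBits (n : ℕ) (c : Bool) (a b : ℕ) (z : Bool) : Qubit n → Bool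
  | .C => c
  | .A i => a.testBit i
  | .B i => b.testBit i
  | .Z => z

namespace ControlledAdder

/-- `CNOT(A_i, B_i)`. -/
noncomputable def cnotAB {n : ℕ} (i : Fin n) : Instruction (Qubit n) where
  arity := 2
  wires := ⟨![.A i, .B i], by
    intro j k h; fin_cases j <;> fin_cases k <;> simp_all⟩
  op := CNOT

/-- `CNOT(A_i, B_i)` for `i = 1, …, n - 1`. -/
noncomputable def cnotLoop (n : ℕ) : List (Instruction (Qubit n)) :=
  (List.finRange (n - 1)).map fun i => cnotAB ⟨i.val + 1, by omega⟩

/-- `Toffoli(C, A_{n-1}, Z)`. -/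
noncomputable def toffoliCAZ (n : ℕ) (hn : 2 ≤ n) : Instruction (Qubit n) where
  arity := 3
  wires := ⟨![.C, .A ⟨n - 1, by omega⟩, .Z], by
    intro j k h; fin_cases j <;> fin_cases k <;> simp_all⟩
  op := Toffoli

/-- `MCX_3(C, A_{n-1}, B_{n-1}, Z)`. -/
noncomputable def mcxCABZ (n : ℕ) (hn : 2 ≤ n) : Instruction (Qubit n) where
  arity := 4
  wires := ⟨![.C, .A ⟨n - 1, by omega⟩, .B ⟨n - 1, by omega⟩, .Z], by
    intro j k h; fin_cases j <;> fin_cases k <;> simp_all⟩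
  op := MCX 3

/-- `Toffoli(C, A_0, B_0)`. -/
noncomputable def toffoliCAB (n : ℕ) (hn : 2 ≤ n) : Instruction (Qubit n) where
  arity := 3
  wires := ⟨![.C, .A ⟨0, by omega⟩, .B ⟨0, by omega⟩], by
    intro j k h; fin_cases j <;> fin_cases k <;> simp_all⟩
  op := Toffoli

/-- The qubits `(A_1, …, A_{n-1})`. -/
def wiresA (n : ℕ) (hn : 2 ≤ n) : Fin (n - 2 + 1) ↪ Qubit n where
  toFun j := .A ⟨j.val + 1, by omega⟩
  inj' := by
    intro j k h
    simp only [Qubit.A.injEq, Fin.mk.injEq] at h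
    omega

/-- The qubits `(A_0, B_0, …, A_{n-2}, B_{n-2}, A_{n-1})`. -/
def wiresAB (n : ℕ) (hn : 2 ≤ n) : Fin (2 * (n - 1) + 1) ↪ Qubit n where
  toFun j :=
    if j.val % 2 = 0 then .A ⟨j.val / 2, by omega⟩ else .B ⟨j.val / 2, by omega⟩
  inj' := by
    intro j k h
    dsimp only at h
    split_ifs at h <;>
      simp only [Qubit.A.injEq, Qubit.B.injEq, Fin.mk.injEq] at h
    all_goals omega

/-- The qubits `(C, A_1, B_1, …, A_{n-1}, B_{n-1})`. -/
def wiresCAB (n : ℕ) (hn : 2 ≤ n) : Fin (2 * (n - 1) + 1) ↪ Qubit n where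
  toFun j :=
    if j.val = 0 then .C
    else if j.val % 2 = 1 then .A ⟨(j.val + 1) / 2, by omega⟩
    else .B ⟨j.val / 2, by omega⟩
  inj' := by
    intro j k h
    dsimp only at h
    split_ifs at h <;>
      simp only [Qubit.A.injEq, Qubit.B.injEq, Fin.mk.injEq] at h
    all_goals omega

/-- The qubits `(C, B_1, …, B_{n-2})`. -/
def wiresCB (n : ℕ) (hn : 2 ≤ n) : Fin (n - 2 + 1) ↪ Qubit n where
  toFun j := if j.val = 0 then .C else .B ⟨j.val, by omega⟩
  inj' := by
    intro j k h
    dsimp only at h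
    split_ifs at h <;>
      simp only [Qubit.B.injEq, Fin.mk.injEq] at h
    all_goals omega

end ControlledAdder

open ControlledAdder in
/-- The ancilla-free controlled ripple-carry adder on `n`-bit registers. The dagger is the adjoint
operator. -/
noncomputable def controlledAdder (n : ℕ) (hn : 2 ≤ n) : List (Instruction (Qubit n)) :=
  -- Slice 1
  cnotLoop n ++
  -- Slice 2
  [toffoliCAZ n hn,
   ⟨_, wiresA n hn, ladder1 (n - 2)⟩] ++
  -- Slice 3
  [⟨_, wiresAB n hn, LinearMap.adjoint (ladder2 (n - 1))⟩,
   mcxCABZ n hn] ++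
  -- Slice 4
  [⟨_, wiresCAB n hn, fanOut2 (n - 1)⟩] ++
  -- Slice 5
  [⟨_, wiresCB n hn, fanOut1 (n - 2)⟩,
   ⟨_, wiresAB n hn, ladder2 (n - 1)⟩,
   ⟨_, wiresCB n hn, fanOut1 (n - 2)⟩] ++
  -- Slice 6
  [⟨_, wiresA n hn, LinearMap.adjoint (ladder1 (n - 2))⟩] ++
  -- Slice 7
  [toffoliCAB n hn] ++
  cnotLoop n

/-!
All operators involved permute the computational basis, so that they are determined by maps on bit
assignments: the operator of a circuit `G` is `basisOp (Circuit.run G)`, and an instruction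
`basisOp f` on the qubits `w` is `basisOp (liftMap w f)`. Everything is therefore proved about bits
and transferred by `toOp_of_run` and, for adjoints, by `toOp_reverse_of_run`, a reversed circuit
being the inverse. Depths are bounded through `Fits`, an explicit distribution of the gates over
time steps, which behaves well under composition, parallel composition and reversal.

*The sum.* With carries `κ_{i+1} = maj(a_i, b_i, κ_i) = a_i ⊕ (a_i ⊕ κ_i)(a_i ⊕ b_i)`, the bits
`A_i = a_i ⊕ κ_i` solve `A_{i+1} ⊕ A_i B_i = a_{i+1} ⊕ a_i` for `B_i = a_i ⊕ b_i`, `i ≥ 1`,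
and `A_1 ⊕ a_0 b_0 = a_1`, so they are obtained from the output of `L₁` by `L₂†`. If `c = 1`, then `F₂` makes `B_i` equal to
`b_i ⊕ κ_i`, and since `b_i ⊕ κ_i ⊕ 1 = a_i ⊕ b_i` whenever `a_i ⊕ κ_i = 1`, complementing
`B_i` by `F₁` lets `L₂` undo the carries. This is `ControlledAdder.programOp_controlledAdder`.

*The depth.* The inverse of a ladder is a recurrence `t'_j = t_j ⊕ p_j t'_{j-1}`. Merging pairs of
consecutive steps halves its length (`ladderCircuit`, `IsCarryFamily.run_ladderCircuit`). A merged
step over `2^ℓ` indices is a NOT gate on `t_{(j+1) 2^ℓ}` controlled by `t_{j 2^ℓ}` and by the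
`2^ℓ` bits `p` in between.

* For `L₁` there are no bits `p`, and the steps are CNOT gates: the depth is `O(log m)` with `O(m)`
  gates. Conjugating one CNOT gate by this ladder gives `F₁` (`fanOutCircuit`). For `F₂`, the
  control is added to borrowed qubits between two layers of Toffoli gates, each half of the targets
  being borrowed for the other half (`fanOut2Circuit`).
* For `L₂` a merged step is a multi-controlled X gate with about `2^ℓ` controls, which may borrow
  the `2^ℓ - 1` qubits `t` in between; steps of the same layer then act on disjoint sets of qubits.
  It is done in depth `O(ℓ)` with `O(2^ℓ)` gates (`logMCX`). As borrowed qubits have unknown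
  values, the controls themselves serve as work space: if they are all `1`, adding the bit `a = 1`
  to them makes them clean. They are arranged in levels `[2^k, 2^{k+1})`; in each level, products
  of four controls of the next level are stored at the even positions, and multiplied together by
  a binary tree whose inner nodes are the odd positions (`prepCircuit`). If the levels up to `k`
  are all `1`, the root in level `k` tells whether level `k + 1` is, so that the product of the
  `O(ℓ)` roots is right, and it is added to the target by a linear-size cascade (`mcxDirty`). The
  bit `a` is borrowed too; doing this twice, with `a` toggled in between by the product of two of
  the controls, makes the case `a = 1` occur exactly once if these controls are `1`, and the effect
  cancel otherwise.

The sum over the `O(log n)` layers gives depth `O(log² n)` and `O(n log n)` gates for `L₂`, which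
dominates all the other operators.
-/

/-! ### Classical semantics of reversible circuits -/

section Classical

variable {Q : Type}

/-- The set of qubits on which some gate of the circuit acts. -/
def Circuit.qubits (G : Circuit Q) : Set Q := {q | ∃ g ∈ G, q ∈ g.support}

@[simp] theorem Circuit.qubits_nil : Circuit.qubits ([] : Circuit Q) = ∅ := by
  simp [Circuit.qubits]

@[simp] theorem Circuit.qubits_append (G H : Circuit Q) :
    Circuit.qubits (G ++ H) = Circuit.qubits G ∪ Circuit.qubits H := by
  ext q; simp only [Circuit.qubits, List.mem_append, Set.mem_ofPred_eq, Set.mem_union]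
  constructor
  · rintro ⟨g, h | h, hq⟩
    exacts [.inl ⟨g, h, hq⟩, .inr ⟨g, h, hq⟩]
  · rintro (⟨g, h, hq⟩ | ⟨g, h, hq⟩)
    exacts [⟨g, .inl h, hq⟩, ⟨g, .inr h, hq⟩]

@[simp] theorem Circuit.qubits_reverse (G : Circuit Q) :
    Circuit.qubits G.reverse = Circuit.qubits G := by
  simp [Circuit.qubits]

theorem Circuit.mem_qubits_flatMap {ι : Type*} {l : List ι} {f : ι → Circuit Q} {q : Q} :
    q ∈ Circuit.qubits (l.flatMap f) ↔ ∃ i ∈ l, q ∈ Circuit.qubits (f i) := by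
  simp only [Circuit.qubits, List.mem_flatMap, Set.mem_ofPred_eq]
  constructor
  · rintro ⟨g, ⟨i, hi, hg⟩, hq⟩
    exact ⟨i, hi, g, hg, hq⟩
  · rintro ⟨i, hi, g, hg, hq⟩
    exact ⟨g, ⟨i, hi, hg⟩, hq⟩

variable [DecidableEq Q]

/-- The action of a gate on bit assignments. -/
def Gate.act : Gate Q → (Q → Bool) → Q → Bool
  | .cnot w, x => Function.update x (w 1) (xor (x (w 1)) (x (w 0)))
  | .toffoli w, x => Function.update x (w 2) (xor (x (w 2)) (x (w 0) && x (w 1)))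

/-- The action of a circuit on bit assignments. -/
def Circuit.run (G : Circuit Q) (x : Q → Bool) : Q → Bool :=
  G.foldl (fun y g => g.act y) x

@[simp] theorem Circuit.run_nil (x : Q → Bool) : Circuit.run [] x = x := rfl

@[simp] theorem Circuit.run_cons (g : Gate Q) (G : Circuit Q) (x : Q → Bool) :
    Circuit.run (g :: G) x = Circuit.run G (g.act x) := rfl

@[simp] theorem Circuit.run_append (G H : Circuit Q) (x : Q → Bool) :
    Circuit.run (G ++ H) x = Circuit.run H (Circuit.run G x) := by
  simp [Circuit.run, List.foldl_append]

theorem Gate.act_act (g : Gate Q) (x : Q → Bool) : g.act (g.act x) = x := by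
  cases g with
  | cnot w =>
    simp [Gate.act]
  | toffoli w =>
    simp [Gate.act]

@[simp] theorem Circuit.run_reverse_run (G : Circuit Q) (x : Q → Bool) :
    Circuit.run G.reverse (Circuit.run G x) = x := by
  induction G generalizing x with
  | nil => rfl
  | cons g G ih => simp [ih, Gate.act_act]

@[simp] theorem Circuit.run_run_reverse (G : Circuit Q) (x : Q → Bool) :
    Circuit.run G (Circuit.run G.reverse x) = x := by
  simpa using Circuit.run_reverse_run G.reverse x

theorem Gate.act_of_notMem (g : Gate Q) (x : Q → Bool) {q : Q} (h : q ∉ g.support) :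
    g.act x q = x q := by
  cases g with
  | cnot w =>
    have : q ≠ w 1 := by rintro rfl; simp [Gate.support] at h
    simp [Gate.act, this]
  | toffoli w =>
    have : q ≠ w 2 := by rintro rfl; simp [Gate.support] at h
    simp [Gate.act, this]

theorem Circuit.run_of_notMem (G : Circuit Q) (x : Q → Bool) {q : Q} (h : q ∉ Circuit.qubits G) :
    Circuit.run G x q = x q := by
  induction G generalizing x with
  | nil => rfl
  | cons g G ih =>
    have h1 : q ∉ g.support := fun hq => h ⟨g, by simp, hq⟩
    have h2 : q ∉ Circuit.qubits G := fun ⟨g', hg, hq⟩ => h ⟨g', by simp [hg], hq⟩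
    rw [Circuit.run_cons, ih _ h2, Gate.act_of_notMem _ _ h1]

/-- A circuit only reads and writes its own qubits. -/
theorem Circuit.run_congr (G : Circuit Q) {x y : Q → Bool}
    {S : Set Q} (hS : Circuit.qubits G ⊆ S) (h : ∀ q ∈ S, x q = y q) :
    ∀ q ∈ S, Circuit.run G x q = Circuit.run G y q := by
  induction G generalizing x y with
  | nil => simpa using h
  | cons g G ih =>
    have hg : ∀ q ∈ g.support, q ∈ S := fun q hq => hS ⟨g, by simp, hq⟩
    refine ih (fun q ⟨g', hg', hq⟩ => hS ⟨g', by simp [hg'], hq⟩) ?_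
    intro q hq
    cases g with
    | cnot w =>
      have h0 := h _ (hg (w 0) (by simp [Gate.support]))
      have h1 := h _ (hg (w 1) (by simp [Gate.support]))
      simp only [Gate.act, Function.update_apply, h0, h1, h q hq]
    | toffoli w =>
      have h0 := h _ (hg (w 0) (by simp [Gate.support]))
      have h1 := h _ (hg (w 1) (by simp [Gate.support]))
      have h2 := h _ (hg (w 2) (by simp [Gate.support]))
      simp only [Gate.act, Function.update_apply, h0, h1, h2, h q hq]

theorem Circuit.run_update_of_notMem (G : Circuit Q) (x : Q → Bool) {q : Q} (b : Bool)
    (h : q ∉ Circuit.qubits G) :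
    Circuit.run G (Function.update x q b) = Function.update (Circuit.run G x) q b := by
  funext q'
  by_cases hq : q' = q
  · subst hq
    rw [Circuit.run_of_notMem _ _ h, Function.update_self, Function.update_self]
  · rw [Function.update_of_ne hq]
    refine Circuit.run_congr G (S := {r | r ≠ q}) ?_ ?_ q' hq
    · rintro r hr rfl
      exact h hr
    · intro r hr
      rw [Function.update_of_ne hr]

/-- A sequence of circuits each of which toggles one qubit `t i`, depending on bits not changed
earlier, toggles all these qubits according to the initial bits. -/
theorem Circuit.run_flatMap_toggle {f : ℕ → Circuit Q} {t : ℕ → Q} {g : ℕ → (Q → Bool) → Bool}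
    {n : ℕ}
    (hf : ∀ i < n, ∀ x, Circuit.run (f i) x = Function.update x (t i) (xor (x (t i)) (g i x)))
    (ht : ∀ i j, i < j → j < n → t i ≠ t j)
    (hg : ∀ i < n, ∀ x y : Q → Bool, (∀ q, (∀ j < i, q ≠ t j) → x q = y q) → g i x = g i y)
    (x : Q → Bool) :
    (∀ q, (∀ i < n, q ≠ t i) → Circuit.run ((List.range n).flatMap f) x q = x q) ∧
    ∀ i < n, Circuit.run ((List.range n).flatMap f) x (t i) = xor (x (t i)) (g i x) := by
  induction n with
  | zero => simp
  | succ n ih =>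
    obtain ⟨h1, h2⟩ := ih (fun i hi => hf i (by omega)) (fun i j hi hj => ht i j hi (by omega))
      fun i hi => hg i (by omega)
    simp only [List.range_succ, List.flatMap_append, List.flatMap_singleton, Circuit.run_append]
    set y := Circuit.run ((List.range n).flatMap f) x
    rw [hf n (by omega)]
    constructor
    · intro q hq
      rw [Function.update_of_ne (hq n (by omega)), h1 q fun j hj => hq j (by omega)]
    · intro i hi
      rcases Nat.lt_succ_iff_lt_or_eq.1 hi with hi' | rfl
      · rw [Function.update_of_ne (ht i n hi' (by omega)), h2 i hi']
      · rw [Function.update_self, h1 _ fun j hj => (ht j _ hj (by omega)).symm,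
          hg _ (by omega) y x h1]

/-- In a sequence of circuits on disjoint sets of qubits, each acts as if it were alone. -/
theorem Circuit.run_flatMap_disjoint {f : ℕ → Circuit Q} {S : ℕ → Set Q} {n : ℕ}
    (hS : ∀ i < n, Circuit.qubits (f i) ⊆ S i)
    (hdis : ∀ i j, i < j → j < n → Disjoint (S i) (S j)) (x : Q → Bool) :
    ∀ i < n, ∀ q ∈ S i,
      Circuit.run ((List.range n).flatMap f) x q = Circuit.run (f i) x q := by
  induction n with
  | zero => simp
  | succ n ih =>
    simp only [List.range_succ, List.flatMap_append, List.flatMap_singleton, Circuit.run_append]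
    set y := Circuit.run ((List.range n).flatMap f) x with hy
    intro i hi q hq
    rcases Nat.lt_succ_iff_lt_or_eq.1 hi with hi' | rfl
    · rw [Circuit.run_of_notMem, ih (fun i hi => hS i (by omega))
        (fun i j hi hj => hdis i j hi (by omega)) i hi' q hq]
      exact fun h => Set.disjoint_left.1 (hdis i n hi' (by omega)) hq (hS n (by omega) h)
    · refine Circuit.run_congr _ (hS i hi) (fun r hr => ?_) q hq
      rw [hy, Circuit.run_of_notMem]
      intro h
      obtain ⟨j, hj, hrj⟩ := Circuit.mem_qubits_flatMap.1 h
      rw [List.mem_range] at hj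
      exact Set.disjoint_left.1 (hdis j i hj hi) (hS j (by omega) hrj) hr

/-- The CNOT gate with control `a` and target `b`; the empty circuit if `a = b`. -/
def cx (a b : Q) : Circuit Q :=
  if h : a ≠ b then
    [.cnot ⟨![a, b], by intro j k; fin_cases j <;> fin_cases k <;> simp [h, h.symm]⟩]
  else []

/-- The Toffoli gate with controls `a`, `b` and target `c`; the empty circuit if two of the
qubits coincide. -/
def tof (a b c : Q) : Circuit Q :=
  if h : a ≠ b ∧ a ≠ c ∧ b ≠ c then
    [.toffoli ⟨![a, b, c], by
      obtain ⟨h1, h2, h3⟩ := h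
      intro j k
      fin_cases j <;> fin_cases k <;> simp [h1, h2, h3, h1.symm, h2.symm, h3.symm]⟩]
  else []

theorem run_cx {a b : Q} (h : a ≠ b) (x : Q → Bool) :
    Circuit.run (cx a b) x = Function.update x b (xor (x b) (x a)) := by
  rw [cx, dif_pos h]
  rfl

theorem run_tof {a b c : Q} (hab : a ≠ b) (hac : a ≠ c) (hbc : b ≠ c) (x : Q → Bool) :
    Circuit.run (tof a b c) x = Function.update x c (xor (x c) (x a && x b)) := by
  rw [tof, dif_pos ⟨hab, hac, hbc⟩]
  rfl

theorem qubits_cx_subset (a b : Q) : Circuit.qubits (cx a b) ⊆ {a, b} := by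
  unfold cx
  split_ifs with h
  · rintro q ⟨g, hg, hq⟩
    simp only [List.mem_singleton] at hg
    subst hg
    obtain ⟨i, -, rfl⟩ := Finset.mem_map.1 hq
    fin_cases i
    exacts [.inl rfl, .inr rfl]
  · simp

theorem qubits_tof_subset (a b c : Q) : Circuit.qubits (tof a b c) ⊆ {a, b, c} := by
  unfold tof
  split_ifs with h
  · rintro q ⟨g, hg, hq⟩
    simp only [List.mem_singleton] at hg
    subst hg
    obtain ⟨i, -, rfl⟩ := Finset.mem_map.1 hq
    fin_cases i
    exacts [.inl rfl, .inr (.inl rfl), .inr (.inr rfl)]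
  · simp

end Classical

/-! ### Depth and gate count -/

section Cost

variable {Q : Type}

/-- `Fits G d s`: the circuit `G` has at most `s` gates, and these can be put into time steps
`1, …, d` (the labels `e.2` below) such that gates sharing a qubit keep their order. Unlike the
as-soon-as-possible schedule, this notion is visibly symmetric under reversal. -/
def Fits (G : Circuit Q) (d s : ℕ) : Prop :=
  G.length ≤ s ∧ ∃ L : List (Gate Q × ℕ), L.map Prod.fst = G ∧
    (∀ e ∈ L, 1 ≤ e.2 ∧ e.2 ≤ d) ∧
    L.Pairwise fun e f => ¬ Disjoint e.1.support f.1.support → e.2 < f.2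

theorem Fits.mono {G : Circuit Q} {d d' s s' : ℕ} (h : Fits G d s) (hd : d ≤ d') (hs : s ≤ s') :
    Fits G d' s' := by
  obtain ⟨h1, L, h2, h3, h4⟩ := h
  exact ⟨h1.trans hs, L, h2, fun e he => ⟨(h3 e he).1, (h3 e he).2.trans hd⟩, h4⟩

theorem Fits.nil (d s : ℕ) : Fits ([] : Circuit Q) d s :=
  ⟨by simp, [], by simp⟩

theorem Fits.singleton (g : Gate Q) : Fits [g] 1 1 :=
  ⟨by simp, [(g, 1)], by simp⟩

theorem Fits.append {G H : Circuit Q} {d s d' s' : ℕ} (hG : Fits G d s) (hH : Fits H d' s') :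
    Fits (G ++ H) (d + d') (s + s') := by
  obtain ⟨h1, L, h2, h3, h4⟩ := hG
  obtain ⟨k1, M, k2, k3, k4⟩ := hH
  refine ⟨by simpa using add_le_add h1 k1, L ++ M.map fun e => (e.1, d + e.2), ?_, ?_, ?_⟩
  · simp [h2, ← k2, Function.comp_def]
  · intro e he
    rcases List.mem_append.1 he with he | he
    · have := h3 e he; omega
    · obtain ⟨f, hf, rfl⟩ := List.mem_map.1 he
      have := k3 f hf
      dsimp only; omega
  · refine List.pairwise_append.2 ⟨h4, ?_, ?_⟩
    · refine List.pairwise_map.2 (k4.imp fun {e f} h hd => ?_)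
      have := h hd
      dsimp only; omega
    · intro e he f' hf' _
      obtain ⟨f, hf, rfl⟩ := List.mem_map.1 hf'
      have := h3 e he
      have := k3 f hf
      dsimp only; omega

theorem Fits.parallel {G H : Circuit Q} {d s s' : ℕ} (hG : Fits G d s) (hH : Fits H d s')
    (hdis : Disjoint (Circuit.qubits G) (Circuit.qubits H)) :
    Fits (G ++ H) d (s + s') := by
  obtain ⟨h1, L, h2, h3, h4⟩ := hG
  obtain ⟨k1, M, k2, k3, k4⟩ := hH
  refine ⟨by simpa using add_le_add h1 k1, L ++ M, by simp [h2, k2], ?_, ?_⟩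
  · intro e he
    rcases List.mem_append.1 he with he | he
    exacts [h3 e he, k3 e he]
  · refine List.pairwise_append.2 ⟨h4, k4, fun e he f hf hd => (hd ?_).elim⟩
    refine Finset.disjoint_left.2 fun q hq hq' => ?_
    have h : q ∈ Circuit.qubits G := ⟨e.1, h2 ▸ List.mem_map_of_mem he, hq⟩
    exact Set.disjoint_left.1 hdis h ⟨f.1, k2 ▸ List.mem_map_of_mem hf, hq'⟩

theorem Fits.reverse {G : Circuit Q} {d s : ℕ} (hG : Fits G d s) : Fits G.reverse d s := by
  obtain ⟨h1, L, h2, h3, h4⟩ := hG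
  refine ⟨by simpa using h1, (L.map fun e => (e.1, d + 1 - e.2)).reverse, ?_, ?_, ?_⟩
  · simp [List.map_reverse, ← h2, Function.comp_def]
  · intro e he
    obtain ⟨f, hf, rfl⟩ := List.mem_map.1 (List.mem_reverse.1 he)
    have := h3 f hf
    dsimp only; omega
  · refine List.pairwise_reverse.2 (List.pairwise_map.2 (h4.imp_of_mem fun {e f} he hf h hd => ?_))
    have := h (fun hd' => hd hd'.symm)
    have := h3 e he
    have := h3 f hf
    dsimp only; omega

theorem Fits.flatMap_range {f : ℕ → Circuit Q} {n d : ℕ} {s : ℕ → ℕ}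
    (h : ∀ i < n, Fits (f i) d (s i))
    (hdis : ∀ i j, i < j → j < n → Disjoint (Circuit.qubits (f i)) (Circuit.qubits (f j))) :
    Fits ((List.range n).flatMap f) d (∑ i ∈ Finset.range n, s i) := by
  induction n with
  | zero => simpa using Fits.nil _ _
  | succ n ih =>
    rw [List.range_succ, List.flatMap_append, Finset.sum_range_succ]
    refine (ih (fun i hi => h i (by omega)) fun i j hi hj => hdis i j hi (by omega)).parallel
      (by simpa using h n (by omega)) ?_
    refine Set.disjoint_left.2 fun q hq hq' => ?_
    obtain ⟨i, hi, hqi⟩ := Circuit.mem_qubits_flatMap.1 hq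
    exact Set.disjoint_left.1 (hdis i n (List.mem_range.1 hi) (by omega)) hqi (by simpa using hq')

variable [DecidableEq Q]

theorem fits_cx (a b : Q) : Fits (cx a b) 1 1 := by
  unfold cx
  split_ifs
  exacts [Fits.singleton _, Fits.nil _ _]

theorem fits_tof (a b c : Q) : Fits (tof a b c) 1 1 := by
  unfold tof
  split_ifs
  exacts [Fits.singleton _, Fits.nil _ _]

theorem Fits.depth_le [Fintype Q] {G : Circuit Q} {d s : ℕ} (hG : Fits G d s) :
    Circuit.depth G ≤ d := by
  obtain ⟨-, L, rfl, h3, h4⟩ := hG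
  -- Invariant: the last use of a qubit precedes the label of every later gate acting on it.
  suffices h : ∀ t : Q → ℕ, (∀ q, t q ≤ d) → (∀ e ∈ L, ∀ q ∈ e.1.support, t q < e.2) →
      ∀ q, (L.map Prod.fst).foldl Gate.schedule t q ≤ d by
    refine Finset.sup_le fun q _ => h _ (by simp) (fun e he q _ => ?_) q
    have := h3 e he
    omega
  induction L with
  | nil => intro t ht _ q; simpa using ht q
  | cons e L ih =>
    intro t ht hlt q
    rw [List.pairwise_cons] at h4
    have he := h3 e (by simp)
    have hsup : e.1.support.sup t < e.2 :=
      (Finset.sup_lt_iff (Nat.lt_of_lt_of_le Nat.zero_lt_one he.1)).2 fun q hq => hlt e (by simp) q hq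
    refine ih (fun f hf => h3 f (by simp [hf])) h4.2 _ (fun r => ?_) (fun f hf r hr => ?_) q
    · unfold Gate.schedule
      split_ifs
      · omega
      · exact ht r
    · unfold Gate.schedule
      split_ifs with hre
      · have := h4.1 f hf (Finset.not_disjoint_iff.2 ⟨r, hre, hr⟩)
        omega
      · exact hlt f (by simp [hf]) r hr

end Cost

/-! ### Multi-controlled X gates with dirty ancillas -/

section DirtyMCX

variable {Q : Type} [DecidableEq Q]

/-- The V-shaped Toffoli cascade on controls `c 0, …, c (j + 1)` and dirty qubits `d 0, …, d j`. -/
def sweep (c d : ℕ → Q) : ℕ → Circuit Q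
  | 0 => tof (c 0) (c 1) (d 0)
  | j + 1 => tof (c (j + 2)) (d j) (d (j + 1)) ++ sweep c d j ++ tof (c (j + 2)) (d j) (d (j + 1))

/-- The X gate on `t` controlled by `c 0, …, c (j + 2)`, with the help of the qubits
`d 0, …, d j` in arbitrary states, which are restored. -/
def mcxDirty (j : ℕ) (c d : ℕ → Q) (t : Q) : Circuit Q :=
  tof (c (j + 2)) (d j) t ++ sweep c d j ++ tof (c (j + 2)) (d j) t ++ sweep c d j

theorem forall_le_succ_decide (n : ℕ) (f : ℕ → Bool) :
    decide (∀ l ≤ n + 1, f l = true) = (decide (∀ l ≤ n, f l = true) && f (n + 1)) := by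
  rw [Bool.eq_iff_iff]
  simp only [decide_eq_true_eq, Bool.and_eq_true]
  constructor
  · exact fun h => ⟨fun l hl => h l (by omega), h _ le_rfl⟩
  · rintro ⟨h1, h2⟩ l hl
    rcases Nat.le_succ_iff.1 hl with h | rfl
    exacts [h1 l h, h2]

/-- The cascade toggles each `d i` by the product of the controls `c 0, …, c (i + 1)`, whatever
the initial values of the qubits `d i`: the two outer gates add `c (j + 2)` times the old and the
new value of `d j`, whose sum is the product of the first `j + 2` controls. -/
theorem run_sweep {c d : ℕ → Q} {j : ℕ} (hc : c 0 ≠ c 1)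
    (hd : ∀ i i', i < i' → i' ≤ j → d i ≠ d i') (hcd : ∀ i ≤ j + 1, ∀ i' ≤ j, c i ≠ d i')
    (x : Q → Bool) :
    (∀ q, (∀ i ≤ j, q ≠ d i) → Circuit.run (sweep c d j) x q = x q) ∧
      ∀ i ≤ j, Circuit.run (sweep c d j) x (d i) =
        xor (x (d i)) (decide (∀ l ≤ i + 1, x (c l) = true)) := by
  induction j generalizing x with
  | zero =>
    rw [sweep, run_tof hc (hcd 0 (by omega) 0 le_rfl) (hcd 1 (by omega) 0 le_rfl)]
    constructor
    · intro q hq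
      rw [Function.update_of_ne (hq 0 le_rfl)]
    · intro i hi
      obtain rfl : i = 0 := by omega
      rw [Function.update_self, forall_le_succ_decide 0 fun l => x (c l)]
      simp
  | succ j ih =>
    have hg : ∀ y, Circuit.run (tof (c (j + 2)) (d j) (d (j + 1))) y =
        Function.update y (d (j + 1)) (xor (y (d (j + 1))) (y (c (j + 2)) && y (d j))) :=
      run_tof (hcd _ le_rfl _ (by omega)) (hcd _ le_rfl _ le_rfl) (hd _ _ (by omega) le_rfl)
    simp only [sweep, Circuit.run_append]
    set y := Circuit.run (tof (c (j + 2)) (d j) (d (j + 1))) x with hy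
    obtain ⟨h1, h2⟩ := ih (fun i i' hi hi' => hd i i' hi (by omega))
      (fun i hi i' hi' => hcd i (by omega) i' (by omega)) y
    have hyc : ∀ l ≤ j + 2, y (c l) = x (c l) := fun l hl => by
      rw [hy, hg, Function.update_of_ne (hcd l (by omega) _ le_rfl)]
    have hyd : ∀ l ≤ j, y (d l) = x (d l) := fun l hl => by
      rw [hy, hg, Function.update_of_ne (hd l _ (by omega) le_rfl)]
    rw [hg]
    constructor
    · intro q hq
      rw [Function.update_of_ne (hq _ le_rfl), h1 q fun i hi => hq i (by omega), hy, hg,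
        Function.update_of_ne (hq _ le_rfl)]
    · intro i hi
      rcases Nat.le_succ_iff.1 hi with hi | rfl
      · rw [Function.update_of_ne (hd i _ (by omega) le_rfl), h2 i hi, hyd i hi]
        congr 2
        simp only [eq_iff_iff]
        exact forall₂_congr fun l hl => by rw [hyc l (by omega)]
      · rw [Function.update_self, h1 _ fun i hi => (hd i _ (by omega) le_rfl).symm,
          h1 _ fun i hi => hcd _ le_rfl i (by omega), h2 j le_rfl, hyc _ le_rfl, hyd j le_rfl,
          forall_le_succ_decide (j + 1) fun l => x (c l), hy, hg, Function.update_self]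
        have : decide (∀ l ≤ j + 1, Function.update x (d (j + 1))
            (xor (x (d (j + 1))) (x (c (j + 2)) && x (d j))) (c l) = true) =
            decide (∀ l ≤ j + 1, x (c l) = true) := by
          congr 1
          simp only [eq_iff_iff]
          exact forall₂_congr fun l hl => by
            rw [Function.update_of_ne (hcd l (by omega) _ le_rfl)]
        rw [this]
        cases x (d (j + 1)) <;> cases x (c (j + 2)) <;> cases x (d j) <;> simp

theorem run_mcxDirty {j : ℕ} {c d : ℕ → Q} {t : Q} (hc : c 0 ≠ c 1)
    (hd : ∀ i i', i < i' → i' ≤ j → d i ≠ d i') (hcd : ∀ i ≤ j + 2, ∀ i' ≤ j, c i ≠ d i')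
    (hct : ∀ i ≤ j + 2, c i ≠ t) (hdt : ∀ i ≤ j, d i ≠ t) (x : Q → Bool) :
    Circuit.run (mcxDirty j c d t) x =
      Function.update x t (xor (x t) (decide (∀ l ≤ j + 2, x (c l) = true))) := by
  have hg := run_tof (hcd (j + 2) le_rfl j le_rfl) (hct _ le_rfl) (hdt j le_rfl)
  have hs := run_sweep hc hd fun i hi i' hi' => hcd i (by omega) i' hi'
  simp only [mcxDirty, Circuit.run_append]
  set y := Circuit.run (tof (c (j + 2)) (d j) t) x with hy
  set z := Circuit.run (sweep c d j) y with hz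
  set w := Circuit.run (tof (c (j + 2)) (d j) t) z with hw
  have hyq : ∀ q ≠ t, y q = x q := fun q hq => by rw [hy, hg, Function.update_of_ne hq]
  have hwq : ∀ q ≠ t, w q = z q := fun q hq => by rw [hw, hg, Function.update_of_ne hq]
  have hprod : ∀ i ≤ j, decide (∀ l ≤ i + 1, y (c l) = true) =
      decide (∀ l ≤ i + 1, x (c l) = true) := fun i hi => by
    congr 1
    simp only [eq_iff_iff]
    exact forall₂_congr fun l hl => by rw [hyq _ (hct l (by omega))]
  have hzc : ∀ l ≤ j + 2, z (c l) = x (c l) := fun l hl => by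
    rw [hz, (hs y).1 _ fun i hi => hcd l hl i hi, hyq _ (hct l hl)]
  have hprod' : ∀ i ≤ j, decide (∀ l ≤ i + 1, w (c l) = true) =
      decide (∀ l ≤ i + 1, x (c l) = true) := fun i hi => by
    congr 1
    simp only [eq_iff_iff]
    exact forall₂_congr fun l hl => by
      rw [hwq _ (hct l (by omega)), hzc l (by omega)]
  funext q
  by_cases hqd : ∃ i ≤ j, q = d i
  · obtain ⟨i, hi, rfl⟩ := hqd
    rw [(hs w).2 i hi, Function.update_of_ne (hdt i hi), hprod' i hi, hwq _ (hdt i hi), hz,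
      (hs y).2 i hi, hprod i hi, hyq _ (hdt i hi)]
    simp
  · push Not at hqd
    rw [(hs w).1 q hqd]
    by_cases hqt : q = t
    · subst hqt
      rw [Function.update_self, hw, hg, Function.update_self, hzc _ le_rfl, hz,
        (hs y).1 q hqd, (hs y).2 j le_rfl, hprod j le_rfl, hyq _ (hdt j le_rfl), hy, hg,
        Function.update_self, forall_le_succ_decide (j + 1) fun l => x (c l)]
      cases x q <;> cases x (c (j + 2)) <;> cases x (d j) <;> simp
    · rw [Function.update_of_ne hqt, hwq q hqt, hz, (hs y).1 q hqd, hyq q hqt]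

theorem fits_sweep (c d : ℕ → Q) (j : ℕ) : Fits (sweep c d j) (2 * j + 1) (2 * j + 1) := by
  induction j with
  | zero => exact fits_tof _ _ _
  | succ j ih =>
    exact (((fits_tof _ _ _).append ih).append (fits_tof _ _ _)).mono (by omega) (by omega)

theorem fits_mcxDirty (j : ℕ) (c d : ℕ → Q) (t : Q) :
    Fits (mcxDirty j c d t) (4 * j + 4) (4 * j + 4) :=
  ((((fits_tof _ _ _).append (fits_sweep c d j)).append (fits_tof _ _ _)).append
    (fits_sweep c d j)).mono (by omega) (by omega)

theorem mem_qubits_sweep {c d : ℕ → Q} {j : ℕ} {q : Q} (h : q ∈ Circuit.qubits (sweep c d j)) :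
    (∃ l ≤ j + 1, q = c l) ∨ ∃ l ≤ j, q = d l := by
  induction j with
  | zero =>
    rcases qubits_tof_subset _ _ _ h with h | h | h
    exacts [.inl ⟨0, by omega, h⟩, .inl ⟨1, by omega, h⟩, .inr ⟨0, le_rfl, h⟩]
  | succ j ih =>
    have key : q ∈ Circuit.qubits (tof (c (j + 2)) (d j) (d (j + 1))) →
        (∃ l ≤ j + 2, q = c l) ∨ ∃ l ≤ j + 1, q = d l := fun h => by
      rcases qubits_tof_subset _ _ _ h with h | h | h
      exacts [.inl ⟨_, le_rfl, h⟩, .inr ⟨j, by omega, h⟩, .inr ⟨_, le_rfl, h⟩]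
    simp only [sweep, Circuit.qubits_append, Set.mem_union] at h
    rcases h with (h | h) | h
    · exact key h
    · rcases ih h with ⟨l, hl, h⟩ | ⟨l, hl, h⟩
      exacts [.inl ⟨l, by omega, h⟩, .inr ⟨l, by omega, h⟩]
    · exact key h

theorem mem_qubits_mcxDirty {j : ℕ} {c d : ℕ → Q} {t q : Q}
    (h : q ∈ Circuit.qubits (mcxDirty j c d t)) :
    (∃ l ≤ j + 2, q = c l) ∨ (∃ l ≤ j, q = d l) ∨ q = t := by
  have key : q ∈ Circuit.qubits (tof (c (j + 2)) (d j) t) →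
      (∃ l ≤ j + 2, q = c l) ∨ (∃ l ≤ j, q = d l) ∨ q = t := fun h => by
    rcases qubits_tof_subset _ _ _ h with h | h | h
    exacts [.inl ⟨_, le_rfl, h⟩, .inr (.inl ⟨j, le_rfl, h⟩), .inr (.inr h)]
  have key' : q ∈ Circuit.qubits (sweep c d j) →
      (∃ l ≤ j + 2, q = c l) ∨ (∃ l ≤ j, q = d l) ∨ q = t := fun h => by
    rcases mem_qubits_sweep h with ⟨l, hl, h⟩ | h
    exacts [.inl ⟨l, by omega, h⟩, .inr (.inl h)]
  simp only [mcxDirty, Circuit.qubits_append, Set.mem_union] at h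
  rcases h with ((h | h) | h) | h
  exacts [key h, key' h, key h, key' h]

end DirtyMCX

/-! ### Ladders in logarithmic depth -/

section Ladder

variable {Q : Type} [DecidableEq Q]

/-- The product of the bits `p i x` for `lo < i ≤ hi`. -/
def prodBits (p : ℕ → (Q → Bool) → Bool) (x : Q → Bool) (lo hi : ℕ) : Bool :=
  decide (∀ i ∈ Finset.Ioc lo hi, p i x = true)

omit [DecidableEq Q] in
theorem prodBits_mul {p : ℕ → (Q → Bool) → Bool} {x : Q → Bool} {a b c : ℕ} (hab : a ≤ b)
    (hbc : b ≤ c) : prodBits p x a c = (prodBits p x a b && prodBits p x b c) := by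
  rw [Bool.eq_iff_iff]
  simp only [prodBits, decide_eq_true_eq, Bool.and_eq_true, Finset.mem_Ioc, and_imp]
  constructor
  · exact fun h => ⟨fun i h1 h2 => h i h1 (by omega), fun i h1 h2 => h i (by omega) h2⟩
  · rintro ⟨h1, h2⟩ i hi hi'
    rcases le_or_gt i b with h | h
    exacts [h1 i hi h, h2 i h hi']

/-- `blk ℓ j` are circuits that carry the bit of `T (j 2^ℓ)` over to `T ((j + 1) 2^ℓ)` through the
`2^ℓ` propagate bits `p i` in between; non-adjacent ones act on disjoint sets of qubits. -/
structure IsCarryFamily (T : ℕ → Q) (p : ℕ → (Q → Bool) → Bool) (m : ℕ)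
    (blk : ℕ → ℕ → Circuit Q) : Prop where
  T_ne : ∀ i j, i < j → j ≤ m → T i ≠ T j
  p_congr : ∀ i, 0 < i → i ≤ m → ∀ x y : Q → Bool,
    (∀ q, (∀ j ≤ m, q ≠ T j) → x q = y q) → p i x = p i y
  run_blk : ∀ ℓ j x, (j + 1) * 2 ^ ℓ ≤ m → Circuit.run (blk ℓ j) x =
    Function.update x (T ((j + 1) * 2 ^ ℓ)) (xor (x (T ((j + 1) * 2 ^ ℓ)))
      (x (T (j * 2 ^ ℓ)) && prodBits p x (j * 2 ^ ℓ) ((j + 1) * 2 ^ ℓ)))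
  disjoint : ∀ ℓ j j', j + 2 ≤ j' → (j' + 1) * 2 ^ ℓ ≤ m →
    Disjoint (Circuit.qubits (blk ℓ j)) (Circuit.qubits (blk ℓ j'))

/-- The first `n` blocks of level `ℓ` whose index has the parity of `o`. -/
def ladderLayer (blk : ℕ → ℕ → Circuit Q) (ℓ o n : ℕ) : Circuit Q :=
  (List.range n).flatMap fun i => blk ℓ (2 * i + o)

/-- The recursive ladder on the qubits `T (j 2^ℓ)`, with `k` levels of recursion: merge pairs of
steps, run the ladder on every second qubit, and fill in the remaining ones. -/
def ladderCircuit (blk : ℕ → ℕ → Circuit Q) (m : ℕ) : ℕ → ℕ → Circuit Q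
  | 0, _ => []
  | k + 1, ℓ => ladderLayer blk ℓ 1 (m / 2 ^ (ℓ + 1)) ++ ladderCircuit blk m k (ℓ + 1) ++
      ladderLayer blk ℓ 0 ((m / 2 ^ ℓ + 1) / 2)

variable {T : ℕ → Q} {p : ℕ → (Q → Bool) → Bool} {m : ℕ} {blk : ℕ → ℕ → Circuit Q}

theorem IsCarryFamily.prodBits_congr (h : IsCarryFamily T p m blk) {x y : Q → Bool}
    (hxy : ∀ q, (∀ j ≤ m, q ≠ T j) → x q = y q) (a : ℕ) {b : ℕ} (hb : b ≤ m) :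
    prodBits p x a b = prodBits p y a b := by
  unfold prodBits
  congr 1
  simp only [eq_iff_iff, Finset.mem_Ioc]
  exact forall₂_congr fun i hi => by rw [h.p_congr i (by omega) (by omega) x y hxy]

theorem IsCarryFamily.T_inj (h : IsCarryFamily T p m blk) {i j : ℕ} (hi : i ≤ m) (hj : j ≤ m)
    (hij : i ≠ j) : T i ≠ T j := by
  rcases Nat.lt_or_gt_of_ne hij with h' | h'
  exacts [h.T_ne i j h' hj, (h.T_ne j i h' hi).symm]

theorem IsCarryFamily.run_layer (h : IsCarryFamily T p m blk) (ℓ o n : ℕ)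
    (hn : ∀ i < n, (2 * i + o + 1) * 2 ^ ℓ ≤ m) (x : Q → Bool) :
    (∀ q, (∀ i < n, q ≠ T ((2 * i + o + 1) * 2 ^ ℓ)) →
      Circuit.run (ladderLayer blk ℓ o n) x q = x q) ∧
    ∀ i < n, Circuit.run (ladderLayer blk ℓ o n) x (T ((2 * i + o + 1) * 2 ^ ℓ)) =
      xor (x (T ((2 * i + o + 1) * 2 ^ ℓ))) (x (T ((2 * i + o) * 2 ^ ℓ)) &&
        prodBits p x ((2 * i + o) * 2 ^ ℓ) ((2 * i + o + 1) * 2 ^ ℓ)) := by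
  have hne : ∀ i j, i < j → j < n →
      T ((2 * i + o + 1) * 2 ^ ℓ) ≠ T ((2 * j + o + 1) * 2 ^ ℓ) := fun i j hij hj =>
    h.T_ne _ _ (Nat.mul_lt_mul_of_pos_right (by omega) (by positivity)) (hn j hj)
  refine Circuit.run_flatMap_toggle (g := fun i x => x (T ((2 * i + o) * 2 ^ ℓ)) &&
    prodBits p x ((2 * i + o) * 2 ^ ℓ) ((2 * i + o + 1) * 2 ^ ℓ))
    (fun i hi x => h.run_blk ℓ _ x (hn i hi)) hne (fun i hi x y hxy => ?_) x
  rw [h.prodBits_congr (fun q hq => hxy q fun j hj => hq _ (hn j (by omega))) _ (hn i hi),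
    hxy _ fun j hj => (h.T_ne _ _ (Nat.mul_lt_mul_of_pos_right (by omega) (by positivity))
      ((Nat.mul_le_mul_right _ (by omega)).trans (hn i hi))).symm]

/-- The recursive ladder computes the carry recurrence `t'_j = t_j ⊕ p_j t'_{j-1}` over the
multiples of `2^ℓ`, with merged propagate bits. -/
theorem IsCarryFamily.run_ladderCircuit (h : IsCarryFamily T p m blk) (k ℓ : ℕ)
    (hm : m < 2 ^ (k + ℓ)) (x : Q → Bool) :
    (∀ q, (∀ j, (j + 1) * 2 ^ ℓ ≤ m → q ≠ T ((j + 1) * 2 ^ ℓ)) →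
      Circuit.run (ladderCircuit blk m k ℓ) x q = x q) ∧
    ∀ j, (j + 1) * 2 ^ ℓ ≤ m → Circuit.run (ladderCircuit blk m k ℓ) x (T ((j + 1) * 2 ^ ℓ)) =
      xor (x (T ((j + 1) * 2 ^ ℓ))) (Circuit.run (ladderCircuit blk m k ℓ) x (T (j * 2 ^ ℓ)) &&
        prodBits p x (j * 2 ^ ℓ) ((j + 1) * 2 ^ ℓ)) := by
  induction k generalizing ℓ x with
  | zero =>
    refine ⟨fun q _ => by simp [ladderCircuit], fun j hj => ?_⟩
    rw [Nat.zero_add] at hm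
    have : 2 ^ ℓ ≤ (j + 1) * 2 ^ ℓ := Nat.le_mul_of_pos_left _ (by omega)
    omega
  | succ k ih =>
    have hpos : 0 < 2 ^ ℓ := by positivity
    have hdbl : ∀ a, a * 2 ^ (ℓ + 1) = 2 * a * 2 ^ ℓ := fun a => by ring
    have hup : ∀ i, i < m / 2 ^ (ℓ + 1) ↔ (2 * i + 1 + 1) * 2 ^ ℓ ≤ m := fun i => by
      rw [← Nat.succ_le_iff, Nat.le_div_iff_mul_le (by positivity), Nat.succ_eq_add_one, hdbl]
      ring_nf
    have hdn : ∀ i, i < (m / 2 ^ ℓ + 1) / 2 ↔ (2 * i + 0 + 1) * 2 ^ ℓ ≤ m := fun i => by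
      rw [← Nat.le_div_iff_mul_le hpos]
      omega
    obtain ⟨u1, u2⟩ := h.run_layer ℓ 1 (m / 2 ^ (ℓ + 1)) (fun i hi => (hup i).1 hi) x
    simp only [ladderCircuit, Circuit.run_append]
    set y := Circuit.run (ladderLayer blk ℓ 1 (m / 2 ^ (ℓ + 1))) x with hy
    obtain ⟨r1, r2⟩ := ih (ℓ + 1) (by rwa [← Nat.add_assoc, Nat.add_right_comm]) y
    set z := Circuit.run (ladderCircuit blk m k (ℓ + 1)) y with hz
    obtain ⟨d1, d2⟩ := h.run_layer ℓ 0 ((m / 2 ^ ℓ + 1) / 2) (fun i hi => (hdn i).1 hi) z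
    set w := Circuit.run (ladderLayer blk ℓ 0 ((m / 2 ^ ℓ + 1) / 2)) z with hw
    have hne : ∀ a b, a * 2 ^ ℓ ≤ m → b * 2 ^ ℓ ≤ m → a ≠ b → T (a * 2 ^ ℓ) ≠ T (b * 2 ^ ℓ) :=
      fun a b ha hb hab => h.T_inj ha hb fun e => hab (Nat.eq_of_mul_eq_mul_right hpos e)
    -- only the qubits `T i` ever change
    have hyT : ∀ q, (∀ j ≤ m, q ≠ T j) → y q = x q := fun q hq =>
      u1 q fun i hi => hq _ ((hup i).1 hi)
    have hzT : ∀ q, (∀ j ≤ m, q ≠ T j) → z q = x q := fun q hq =>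
      (r1 q fun j hj => hq _ hj).trans (hyT q hq)
    -- odd multiples keep their value until the last layer, even ones from then on
    have hodd : ∀ i, (2 * i + 1) * 2 ^ ℓ ≤ m →
        z (T ((2 * i + 1) * 2 ^ ℓ)) = x (T ((2 * i + 1) * 2 ^ ℓ)) := fun i hi => by
      rw [r1, u1]
      · exact fun j hj => hne _ _ hi ((hup j).1 hj) (by omega)
      · intro j hj
        rw [hdbl] at hj ⊢
        exact hne _ _ hi hj (by omega)
    have heven : ∀ i, 2 * i * 2 ^ ℓ ≤ m →
        w (T (2 * i * 2 ^ ℓ)) = z (T (2 * i * 2 ^ ℓ)) := fun i hi =>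
      d1 _ fun j hj => hne _ _ hi ((hdn j).1 hj) (by omega)
    have hwodd : ∀ i, (2 * i + 1) * 2 ^ ℓ ≤ m → w (T ((2 * i + 1) * 2 ^ ℓ)) =
        xor (x (T ((2 * i + 1) * 2 ^ ℓ))) (w (T (2 * i * 2 ^ ℓ)) &&
          prodBits p x (2 * i * 2 ^ ℓ) ((2 * i + 1) * 2 ^ ℓ)) := fun i hi => by
      have := d2 i ((hdn i).2 hi)
      simp only [Nat.add_zero] at this
      rw [this, hodd i hi, heven i ((Nat.mul_le_mul_right _ (by omega)).trans hi),
        h.prodBits_congr hzT _ hi]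
    constructor
    · intro q hq
      rw [d1 q fun i hi => hq (2 * i) ((hdn i).1 hi), r1 q fun j hj => ?_,
        u1 q fun i hi => hq (2 * i + 1) ((hup i).1 hi)]
      rw [hdbl] at hj ⊢
      exact hq (2 * j + 1) hj
    · intro j hj
      rcases Nat.even_or_odd' j with ⟨i, rfl | rfl⟩
      · exact hwodd i hj
      · have hi1 : (2 * i + 1) * 2 ^ ℓ ≤ m := (Nat.mul_le_mul_right _ (by omega)).trans hj
        have hi0 : 2 * i * 2 ^ ℓ ≤ m := (Nat.mul_le_mul_right _ (by omega)).trans hj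
        have e : 2 * i + 1 + 1 = 2 * (i + 1) := by ring
        have hr := r2 i (by rw [hdbl, ← e]; exact hj)
        rw [hdbl, hdbl, ← e, u2 i ((hup i).2 hj),
          h.prodBits_congr hyT _ hj, prodBits_mul (a := 2 * i * 2 ^ ℓ) (b := (2 * i + 1) * 2 ^ ℓ)
            (Nat.mul_le_mul_right _ (by omega)) (Nat.mul_le_mul_right _ (by omega))] at hr
        have hw' : w (T ((2 * i + 1 + 1) * 2 ^ ℓ)) = z (T ((2 * i + 1 + 1) * 2 ^ ℓ)) := by
          rw [e]; exact heven (i + 1) (by rw [← e]; exact hj)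
        rw [hw', hr, hwodd i hi1, heven i hi0]
        generalize x (T ((2 * i + 1 + 1) * 2 ^ ℓ)) = b1
        generalize x (T ((2 * i + 1) * 2 ^ ℓ)) = b2
        generalize prodBits p x ((2 * i + 1) * 2 ^ ℓ) ((2 * i + 1 + 1) * 2 ^ ℓ) = b3
        generalize prodBits p x (2 * i * 2 ^ ℓ) ((2 * i + 1) * 2 ^ ℓ) = b4
        generalize z (T (2 * i * 2 ^ ℓ)) = b5
        cases b1 <;> cases b2 <;> cases b3 <;> cases b4 <;> cases b5 <;> rfl

theorem IsCarryFamily.fits_layer (h : IsCarryFamily T p m blk) {ℓ o n D S : ℕ}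
    (hn : ∀ i < n, (2 * i + o + 1) * 2 ^ ℓ ≤ m)
    (hf : ∀ j, (j + 1) * 2 ^ ℓ ≤ m → Fits (blk ℓ j) D S) :
    Fits (ladderLayer blk ℓ o n) D (n * S) := by
  have := Fits.flatMap_range (f := fun i => blk ℓ (2 * i + o)) (n := n) (d := D) (s := fun _ => S)
    (fun i hi => hf _ (hn i hi)) fun i j hij hj => h.disjoint _ _ _ (by omega) (hn j hj)
  simpa [ladderLayer] using this

theorem IsCarryFamily.fits_ladderCircuit (h : IsCarryFamily T p m blk) {D S : ℕ → ℕ}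
    (hf : ∀ ℓ j, (j + 1) * 2 ^ ℓ ≤ m → Fits (blk ℓ j) (D ℓ) (S ℓ)) (k ℓ : ℕ) :
    Fits (ladderCircuit blk m k ℓ) (∑ i ∈ Finset.range k, 2 * D (ℓ + i))
      (∑ i ∈ Finset.range k, 2 * (m / 2 ^ (ℓ + i) * S (ℓ + i))) := by
  induction k generalizing ℓ with
  | zero => exact Fits.nil _ _
  | succ k ih =>
    have hpos : 0 < 2 ^ ℓ := by positivity
    have hup : ∀ i < m / 2 ^ (ℓ + 1), (2 * i + 1 + 1) * 2 ^ ℓ ≤ m := fun i hi => by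
      rw [← Nat.succ_le_iff, Nat.le_div_iff_mul_le (by positivity)] at hi
      calc (2 * i + 1 + 1) * 2 ^ ℓ = i.succ * 2 ^ (ℓ + 1) := by rw [Nat.succ_eq_add_one]; ring
        _ ≤ m := hi
    have hdn : ∀ i < (m / 2 ^ ℓ + 1) / 2, (2 * i + 0 + 1) * 2 ^ ℓ ≤ m := fun i hi => by
      rw [← Nat.le_div_iff_mul_le hpos]
      omega
    have := ((h.fits_layer hup (hf ℓ)).append (ih (ℓ + 1))).append (h.fits_layer (o := 0) hdn (hf ℓ))
    have e : ∀ i, ℓ + 1 + i = ℓ + (i + 1) := fun i => by ring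
    simp only [e] at this
    rw [Finset.sum_range_succ', Finset.sum_range_succ']
    refine this.mono (by simp only [Nat.add_zero]; omega) ?_
    have h1 : m / 2 ^ (ℓ + 1) * S ℓ + (m / 2 ^ ℓ + 1) / 2 * S ℓ ≤ 2 * (m / 2 ^ ℓ * S ℓ) := by
      rw [← Nat.add_mul, ← Nat.mul_assoc]
      refine Nat.mul_le_mul_right _ ?_
      rw [pow_succ, ← Nat.div_div_eq_div_mul]
      omega
    simp only [Nat.add_zero]
    omega

omit [DecidableEq Q] in
theorem qubits_ladderCircuit_subset {R : Set Q} (k ℓ : ℕ)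
    (hR : ∀ ℓ j, (j + 1) * 2 ^ ℓ ≤ m → Circuit.qubits (blk ℓ j) ⊆ R) :
    Circuit.qubits (ladderCircuit blk m k ℓ) ⊆ R := by
  induction k generalizing ℓ with
  | zero => simp [ladderCircuit]
  | succ k ih =>
    simp only [ladderCircuit, Circuit.qubits_append]
    refine Set.union_subset (Set.union_subset ?_ (ih _)) ?_
    · intro q hq
      obtain ⟨i, hi, hq⟩ := Circuit.mem_qubits_flatMap.1 hq
      refine hR ℓ (2 * i + 1) ?_ hq
      rw [List.mem_range, ← Nat.succ_le_iff, Nat.le_div_iff_mul_le (by positivity)] at hi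
      calc (2 * i + 1 + 1) * 2 ^ ℓ = i.succ * 2 ^ (ℓ + 1) := by rw [Nat.succ_eq_add_one]; ring
        _ ≤ m := hi
    · intro q hq
      obtain ⟨i, hi, hq⟩ := Circuit.mem_qubits_flatMap.1 hq
      refine hR ℓ (2 * i + 0) ?_ hq
      rw [List.mem_range] at hi
      rw [← Nat.le_div_iff_mul_le (by positivity)]
      omega

end Ladder

/-! ### Ladders of CNOT gates and fan-out -/

section FanOut

variable {Q : Type} [DecidableEq Q]

/-- The circuit `w (j + 1) ↦ w 0 ⊕ ⋯ ⊕ w (j + 1)` on the qubits `w 0, …, w m`. -/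
def xorLadder (w : ℕ → Q) (m : ℕ) : Circuit Q :=
  ladderCircuit (fun ℓ j => cx (w (j * 2 ^ ℓ)) (w ((j + 1) * 2 ^ ℓ))) m (Nat.size m) 0

theorem isCarryFamily_cx {w : ℕ → Q} {m : ℕ} (hw : ∀ i j, i < j → j ≤ m → w i ≠ w j) :
    IsCarryFamily w (fun _ _ => true) m fun ℓ j => cx (w (j * 2 ^ ℓ)) (w ((j + 1) * 2 ^ ℓ)) where
  T_ne := hw
  p_congr _ _ _ _ _ _ := rfl
  run_blk ℓ j x hj := by
    rw [run_cx (hw _ _ (Nat.mul_lt_mul_of_pos_right (Nat.lt_succ_self j) (by positivity)) hj)]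
    simp [prodBits]
  disjoint ℓ j j' hjj' hj' := by
    have hne : ∀ a b, a < b → b ≤ j' + 1 → w (a * 2 ^ ℓ) ≠ w (b * 2 ^ ℓ) := fun a b hab hb =>
      hw _ _ (Nat.mul_lt_mul_of_pos_right hab (by positivity))
        ((Nat.mul_le_mul_right _ hb).trans hj')
    refine Set.disjoint_left.2 fun q h h' => ?_
    rcases qubits_cx_subset _ _ h with h | h <;> rcases qubits_cx_subset _ _ h' with h' | h' <;>
      exact hne _ _ (by omega) (by omega) (h.symm.trans h')

theorem run_xorLadder {w : ℕ → Q} {m : ℕ} (hw : ∀ i j, i < j → j ≤ m → w i ≠ w j)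
    (x : Q → Bool) :
    (∀ q, (∀ j < m, q ≠ w (j + 1)) → Circuit.run (xorLadder w m) x q = x q) ∧
    ∀ j < m, Circuit.run (xorLadder w m) x (w (j + 1)) =
      xor (x (w (j + 1))) (Circuit.run (xorLadder w m) x (w j)) := by
  have h := (isCarryFamily_cx hw).run_ladderCircuit (Nat.size m) 0
    (by simpa using Nat.lt_size_self m) x
  simpa [prodBits, xorLadder, Nat.succ_le_iff] using h

theorem fits_xorLadder {w : ℕ → Q} {m : ℕ} (hw : ∀ i j, i < j → j ≤ m → w i ≠ w j) :
    Fits (xorLadder w m) (2 * Nat.size m) (4 * m) := by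
  refine ((isCarryFamily_cx hw).fits_ladderCircuit (D := fun _ => 1) (S := fun _ => 1)
    (fun _ _ _ => fits_cx _ _) (Nat.size m) 0).mono (by simp [Nat.mul_comm]) ?_
  have := Nat.geom_sum_le le_rfl m (Nat.size m)
  simp only [Nat.zero_add, Nat.mul_one, ← Finset.mul_sum]
  omega

theorem mem_qubits_xorLadder {w : ℕ → Q} {m : ℕ} {q : Q}
    (h : q ∈ Circuit.qubits (xorLadder w m)) : ∃ i ≤ m, q = w i := by
  refine qubits_ladderCircuit_subset (R := {q | ∃ i ≤ m, q = w i}) (Nat.size m) 0 ?_ h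
  intro ℓ j hj q hq
  rcases qubits_cx_subset _ _ hq with h | h
  exacts [⟨_, (Nat.mul_le_mul_right _ (Nat.le_succ j)).trans hj, h⟩, ⟨_, hj, h⟩]

/-- The circuit adding the bit of `c` to each of `w 0, …, w (m - 1)`: the CNOT gate from `c` to
`w 0`, conjugated by the ladder computing prefix sums. -/
def fanOutCircuit (c : Q) (w : ℕ → Q) : ℕ → Circuit Q
  | 0 => []
  | m + 1 => (xorLadder w m).reverse ++ cx c (w 0) ++ xorLadder w m

theorem run_fanOutCircuit {c : Q} {w : ℕ → Q} {m : ℕ} (hw : ∀ i j, i < j → j < m → w i ≠ w j)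
    (hc : ∀ i < m, c ≠ w i) (x : Q → Bool) :
    (∀ q, (∀ j < m, q ≠ w j) → Circuit.run (fanOutCircuit c w m) x q = x q) ∧
    ∀ j < m, Circuit.run (fanOutCircuit c w m) x (w j) = xor (x (w j)) (x c) := by
  cases m with
  | zero => simp [fanOutCircuit]
  | succ m =>
    have hw' : ∀ i j, i < j → j ≤ m → w i ≠ w j := fun i j hij hj => hw i j hij (by omega)
    simp only [fanOutCircuit, Circuit.run_append]
    set y := Circuit.run (xorLadder w m).reverse x with hy
    rw [run_cx (hc 0 (by omega))]
    set z := Function.update y (w 0) (xor (y (w 0)) (y c)) with hz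
    have hyx : Circuit.run (xorLadder w m) y = x := by simp [hy]
    obtain ⟨y1, y2⟩ := run_xorLadder hw' y
    obtain ⟨z1, z2⟩ := run_xorLadder hw' z
    rw [hyx] at y1 y2
    constructor
    · intro q hq
      rw [z1 q fun j hj => hq _ (by omega), hz, Function.update_of_ne (hq 0 (by omega)),
        y1 q fun j hj => hq _ (by omega)]
    · intro j hj
      induction j with
      | zero =>
        rw [z1 _ fun j hj => hw' _ _ (by omega) (by omega), hz, Function.update_self,
          y1 c fun j hj => hc _ (by omega), y1 _ fun j hj => hw' _ _ (by omega) (by omega)]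
      | succ j ih =>
        rw [z2 j (by omega), ih (by omega), hz,
          Function.update_of_ne (hw' _ _ (by omega) (by omega)).symm, y2 j (by omega)]
        generalize y (w (j + 1)) = b1
        generalize x (w j) = b2
        generalize x c = b3
        cases b1 <;> cases b2 <;> cases b3 <;> rfl

theorem fits_fanOutCircuit {c : Q} {w : ℕ → Q} {m : ℕ} (hw : ∀ i j, i < j → j < m → w i ≠ w j) :
    Fits (fanOutCircuit c w m) (4 * Nat.size m + 1) (8 * m) := by
  cases m with
  | zero => exact Fits.nil _ _
  | succ m =>
    have hw' : ∀ i j, i < j → j ≤ m → w i ≠ w j := fun i j hij hj => hw i j hij (by omega)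
    have hs : Nat.size m ≤ Nat.size (m + 1) := Nat.size_le_size (by omega)
    exact (((fits_xorLadder hw').reverse.append (fits_cx _ _)).append (fits_xorLadder hw')).mono
      (by omega) (by omega)

theorem mem_qubits_fanOutCircuit {c : Q} {w : ℕ → Q} {m : ℕ} {q : Q}
    (h : q ∈ Circuit.qubits (fanOutCircuit c w m)) : q = c ∨ ∃ i < m, q = w i := by
  cases m with
  | zero => simp [fanOutCircuit] at h
  | succ m =>
    simp only [fanOutCircuit, Circuit.qubits_append, Circuit.qubits_reverse, Set.mem_union] at h
    have key : q ∈ Circuit.qubits (xorLadder w m) → q = c ∨ ∃ i < m + 1, q = w i := fun h => by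
      obtain ⟨i, hi, h⟩ := mem_qubits_xorLadder h
      exact .inr ⟨i, by omega, h⟩
    rcases h with (h | h) | h
    · exact key h
    · rcases qubits_cx_subset _ _ h with h | h
      exacts [.inl h, .inr ⟨0, by omega, h⟩]
    · exact key h

/-- Parallel Toffoli gates with controls `a i`, `b i` and targets `t i`. -/
def tofLayer (a b t : ℕ → Q) (n : ℕ) : Circuit Q :=
  (List.range n).flatMap fun i => tof (a i) (b i) (t i)

theorem run_tofLayer {a b t : ℕ → Q} {n : ℕ} (hab : ∀ i < n, a i ≠ b i)
    (hat : ∀ i < n, ∀ j < n, a i ≠ t j) (hbt : ∀ i < n, ∀ j < n, b i ≠ t j)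
    (ht : ∀ i j, i < j → j < n → t i ≠ t j) (x : Q → Bool) :
    (∀ q, (∀ j < n, q ≠ t j) → Circuit.run (tofLayer a b t n) x q = x q) ∧
    ∀ j < n, Circuit.run (tofLayer a b t n) x (t j) = xor (x (t j)) (x (a j) && x (b j)) := by
  refine Circuit.run_flatMap_toggle (g := fun i x => x (a i) && x (b i))
    (fun i hi => run_tof (hab i hi) (hat i hi i hi) (hbt i hi i hi)) ht (fun i hi x y h => ?_) x
  rw [h _ fun j hj => hat i hi j (by omega), h _ fun j hj => hbt i hi j (by omega)]

theorem fits_tofLayer {a b t : ℕ → Q} {n : ℕ}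
    (hdis : ∀ i j, i < j → j < n → Disjoint ({a i, b i, t i} : Set Q) {a j, b j, t j}) :
    Fits (tofLayer a b t n) 1 n := by
  have := Fits.flatMap_range (f := fun i => tof (a i) (b i) (t i)) (n := n) (d := 1)
    (s := fun _ => 1) (fun i _ => fits_tof _ _ _) fun i j hij hj =>
      (hdis i j hij hj).mono (qubits_tof_subset _ _ _) (qubits_tof_subset _ _ _)
  simpa [tofLayer] using this

/-- The circuit adding `c · u i` to `v i` for all `i < m`, with dirty qubits `e i`, to which the
bit of `c` is added in order to be available `m` times in parallel. -/
def dirtyFanOut2 (c : Q) (u v e : ℕ → Q) (m : ℕ) : Circuit Q :=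
  tofLayer e u v m ++ fanOutCircuit c e m ++ tofLayer e u v m ++ fanOutCircuit c e m

theorem run_dirtyFanOut2 {c : Q} {u v e : ℕ → Q} {m : ℕ}
    (hv : ∀ i j, i < j → j < m → v i ≠ v j) (he : ∀ i j, i < j → j < m → e i ≠ e j)
    (hcv : ∀ i < m, c ≠ v i) (hce : ∀ i < m, c ≠ e i)
    (huv : ∀ i < m, ∀ j < m, u i ≠ v j) (hue : ∀ i < m, ∀ j < m, u i ≠ e j)
    (hve : ∀ i < m, ∀ j < m, v i ≠ e j) (x : Q → Bool) :
    (∀ q, (∀ j < m, q ≠ v j) → Circuit.run (dirtyFanOut2 c u v e m) x q = x q) ∧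
    ∀ j < m, Circuit.run (dirtyFanOut2 c u v e m) x (v j) = xor (x (v j)) (x c && x (u j)) := by
  have hT := run_tofLayer (fun i hi => (hue i hi i hi).symm)
    (fun i hi j hj => (hve j hj i hi).symm) huv hv
  have hF := run_fanOutCircuit he hce
  simp only [dirtyFanOut2, Circuit.run_append]
  obtain ⟨a1, a2⟩ := hT x
  set y := Circuit.run (tofLayer e u v m) x
  obtain ⟨b1, b2⟩ := hF y
  set z := Circuit.run (fanOutCircuit c e m) y
  obtain ⟨c1, c2⟩ := hT z
  set w := Circuit.run (tofLayer e u v m) z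
  obtain ⟨d1, d2⟩ := hF w
  constructor
  · intro q hq
    by_cases hqe : ∃ j < m, q = e j
    · obtain ⟨j, hj, rfl⟩ := hqe
      rw [d2 j hj, c1 _ hq, b2 j hj, a1 _ hq, c1 c hcv, b1 c hce, a1 c hcv]
      simp
    · push Not at hqe
      rw [d1 q hqe, c1 q hq, b1 q hqe, a1 q hq]
  · intro j hj
    rw [d1 _ fun i hi => hve j hj i hi, c2 j hj, b1 _ fun i hi => hve j hj i hi, a2 j hj,
      b2 j hj, b1 _ fun i hi => hue j hj i hi, a1 _ fun i hi => (hve i hi j hj).symm,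
      a1 _ fun i hi => huv j hj i hi, a1 c hcv]
    generalize x (v j) = b1
    generalize x (e j) = b2
    generalize x (u j) = b3
    generalize x c = b4
    cases b1 <;> cases b2 <;> cases b3 <;> cases b4 <;> rfl

theorem fits_dirtyFanOut2 {c : Q} {u v e : ℕ → Q} {m : ℕ}
    (hu : ∀ i j, i < j → j < m → u i ≠ u j)
    (hv : ∀ i j, i < j → j < m → v i ≠ v j) (he : ∀ i j, i < j → j < m → e i ≠ e j)
    (huv : ∀ i < m, ∀ j < m, u i ≠ v j) (hue : ∀ i < m, ∀ j < m, u i ≠ e j)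
    (hve : ∀ i < m, ∀ j < m, v i ≠ e j) :
    Fits (dirtyFanOut2 c u v e m) (8 * Nat.size m + 4) (18 * m) := by
  have hT : Fits (tofLayer e u v m) 1 m := by
    refine fits_tofLayer fun i j hij hj => Set.disjoint_left.2 ?_
    have hi : i < m := by omega
    rintro q (rfl | rfl | rfl) (h | h | h)
    exacts [he i j hij hj h, hue j hj i hi h.symm, hve j hj i hi h.symm,
      hue i hi j hj h, hu i j hij hj h, huv i hi j hj h,
      hve i hi j hj h, huv j hj i hi h.symm, hv i j hij hj h]
  have hF := fits_fanOutCircuit (c := c) he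
  exact (((hT.append hF).append hT).append hF).mono (by omega) (by omega)

/-- The circuit adding `c · u i` to `v i` for all `i < m` without further qubits: each half of
the targets is treated with the other half as dirty qubits. -/
def fanOut2Circuit (c : Q) (u v : ℕ → Q) (m : ℕ) : Circuit Q :=
  dirtyFanOut2 c u v (fun i => v (m / 2 + i)) (m / 2) ++
    dirtyFanOut2 c (fun i => u (m / 2 + i)) (fun i => v (m / 2 + i)) v (m / 2) ++
    if m % 2 = 1 then tof c (u (m - 1)) (v (m - 1)) else []

theorem run_fanOut2Circuit {c : Q} {u v : ℕ → Q} {m : ℕ}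
    (hv : ∀ i j, i < j → j < m → v i ≠ v j)
    (hcu : ∀ i < m, c ≠ u i) (hcv : ∀ i < m, c ≠ v i)
    (huv : ∀ i < m, ∀ j < m, u i ≠ v j) (x : Q → Bool) :
    (∀ q, (∀ j < m, q ≠ v j) → Circuit.run (fanOut2Circuit c u v m) x q = x q) ∧
    ∀ j < m, Circuit.run (fanOut2Circuit c u v m) x (v j) = xor (x (v j)) (x c && x (u j)) := by
  have hne : ∀ i < m, ∀ j < m, i ≠ j → v i ≠ v j := fun i hi j hj hij => by
    rcases Nat.lt_or_gt_of_ne hij with h | h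
    exacts [hv i j h hj, (hv j i h hi).symm]
  simp only [fanOut2Circuit, Circuit.run_append]
  obtain ⟨a1, a2⟩ := run_dirtyFanOut2 (c := c) (u := u) (v := v) (e := fun i => v (m / 2 + i))
    (m := m / 2) (fun i j hi hj => hv i j hi (by omega)) (fun i j hi hj => hv _ _ (by omega)
    (by omega)) (fun i hi => hcv i (by omega))
    (fun i hi => hcv _ (by omega)) (fun i hi j hj => huv _ (by omega) _ (by omega))
    (fun i hi j hj => huv _ (by omega) _ (by omega))
    (fun i hi j hj => hv _ _ (by omega) (by omega)) x
  set y := Circuit.run (dirtyFanOut2 c u v (fun i => v (m / 2 + i)) (m / 2)) x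
  obtain ⟨b1, b2⟩ := run_dirtyFanOut2 (c := c) (u := fun i => u (m / 2 + i))
    (v := fun i => v (m / 2 + i)) (e := v)
    (m := m / 2) (fun i j hi hj => hv _ _ (by omega) (by omega)) (fun i j hi hj => hv _ _ (by omega)
    (by omega)) (fun i hi => hcv _ (by omega))
    (fun i hi => hcv _ (by omega)) (fun i hi j hj => huv _ (by omega) _ (by omega))
    (fun i hi j hj => huv _ (by omega) _ (by omega))
    (fun i hi j hj => (hv _ _ (by omega) (by omega)).symm) y
  set z := Circuit.run (dirtyFanOut2 c (fun i => u (m / 2 + i)) (fun i => v (m / 2 + i)) v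
    (m / 2)) y
  -- the effect of the two halves together
  have hz1 : ∀ q, (∀ j < m / 2 * 2, q ≠ v j) → z q = x q := fun q hq => by
    rw [b1 q fun j hj => hq _ (by omega), a1 q fun j hj => hq _ (by omega)]
  have hz2 : ∀ j < m / 2 * 2, z (v j) = xor (x (v j)) (x c && x (u j)) := fun j hj => by
    rcases lt_or_ge j (m / 2) with h | h
    · rw [b1 _ fun i hi => hv _ _ (by omega) (by omega), a2 j h]
    · have := b2 (j - m / 2) (by omega)
      simp only [Nat.add_sub_cancel' h] at this
      rw [this, a1 _ fun i hi => (hv _ _ (by omega) (by omega)).symm,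
        a1 _ fun i hi => hcv _ (by omega), a1 _ fun i hi => huv _ (by omega) _ (by omega)]
  split_ifs with hm
  · have hml : m - 1 < m := by omega
    rw [run_tof (hcu _ hml) (hcv _ hml) (huv _ hml _ hml)]
    constructor
    · intro q hq
      rw [Function.update_of_ne (hq _ hml), hz1 q fun j hj => hq j (by omega)]
    · intro j hj
      by_cases hjm : j = m - 1
      · subst hjm
        rw [Function.update_self, hz1 _ fun i hi => hne _ hml i (by omega) (by omega),
          hz1 _ fun i hi => hcv i (by omega), hz1 _ fun i hi => huv _ hml i (by omega)]
      · rw [Function.update_of_ne (hne j hj _ hml hjm), hz2 j (by omega)]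
  · exact ⟨fun q hq => hz1 q fun j hj => hq j (by omega), fun j hj => hz2 j (by omega)⟩

theorem fits_fanOut2Circuit {c : Q} {u v : ℕ → Q} {m : ℕ}
    (hu : ∀ i j, i < j → j < m → u i ≠ u j) (hv : ∀ i j, i < j → j < m → v i ≠ v j)
    (huv : ∀ i < m, ∀ j < m, u i ≠ v j) :
    Fits (fanOut2Circuit c u v m) (16 * Nat.size m + 9) (18 * m) := by
  have h1 : Fits (dirtyFanOut2 c u v (fun i => v (m / 2 + i)) (m / 2)) _ _ :=
    fits_dirtyFanOut2 (fun i j hi hj => hu i j hi (by omega)) (fun i j hi hj => hv i j hi (by omega))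
      (fun i j hi hj => hv _ _ (by omega) (by omega))
      (fun i hi j hj => huv _ (by omega) _ (by omega))
      (fun i hi j hj => huv _ (by omega) _ (by omega))
      (fun i hi j hj => hv _ _ (by omega) (by omega))
  have h2 : Fits (dirtyFanOut2 c (fun i => u (m / 2 + i)) (fun i => v (m / 2 + i)) v (m / 2)) _ _ :=
    fits_dirtyFanOut2 (fun i j hi hj => hu _ _ (by omega) (by omega))
      (fun i j hi hj => hv _ _ (by omega) (by omega)) (fun i j hi hj => hv _ _ (by omega) (by omega))
      (fun i hi j hj => huv _ (by omega) _ (by omega))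
      (fun i hi j hj => huv _ (by omega) _ (by omega))
      (fun i hi j hj => (hv _ _ (by omega) (by omega)).symm)
  have hs : Nat.size (m / 2) ≤ Nat.size m := Nat.size_le_size (by omega)
  unfold fanOut2Circuit
  split_ifs with hm
  · exact ((h1.append h2).append (fits_tof _ _ _)).mono (by omega) (by omega)
  · exact ((h1.append h2).append (Fits.nil 0 0)).mono (by omega) (by omega)

end FanOut

/-! ### Logarithmic-depth products in conditionally clean qubits -/

section LogMCX

variable {Q : Type} [DecidableEq Q]

/-- The product of the bits of `w (lo + 2 u)`, `u < 2 ^ h`, computed in a binary tree. The tree is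
laid out in order: the root is at the position `lo + 2 ^ h - 1`, in the middle of the positions
used, and the inner nodes are at odd distances from `lo`. -/
def andTree (w : ℕ → Q) : ℕ → ℕ → Circuit Q
  | 0, _ => []
  | h + 1, lo => andTree w h lo ++ andTree w h (lo + 2 ^ (h + 1)) ++
      tof (w (lo + 2 ^ h - 1)) (w (lo + 2 ^ (h + 1) + 2 ^ h - 1)) (w (lo + 2 ^ (h + 1) - 1))

theorem mem_qubits_andTree {w : ℕ → Q} {h lo : ℕ} {q : Q}
    (hq : q ∈ Circuit.qubits (andTree w h lo)) :
    ∃ i, lo ≤ i ∧ i + 1 < lo + 2 ^ (h + 1) ∧ q = w i := by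
  induction h generalizing lo with
  | zero => simp [andTree] at hq
  | succ h ih =>
    have hpos : 0 < 2 ^ h := by positivity
    have e1 : 2 ^ (h + 1) = 2 * 2 ^ h := by ring
    have e2 : 2 ^ (h + 1 + 1) = 4 * 2 ^ h := by ring
    simp only [andTree, Circuit.qubits_append, Set.mem_union] at hq
    rcases hq with (hq | hq) | hq
    · obtain ⟨i, h1, h2, h3⟩ := ih hq
      exact ⟨i, h1, by omega, h3⟩
    · obtain ⟨i, h1, h2, h3⟩ := ih hq
      exact ⟨i, by omega, by omega, h3⟩
    · rcases qubits_tof_subset _ _ _ hq with h | h | h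
      exacts [⟨_, by omega, by omega, h⟩, ⟨_, by omega, by omega, h⟩, ⟨_, by omega, by omega, h⟩]

theorem run_andTree {w : ℕ → Q} {N : ℕ} (hw : ∀ i j, i < j → j < N → w i ≠ w j) (h lo : ℕ)
    (hN : lo + 2 ^ (h + 1) ≤ N) (x : Q → Bool)
    (hx : ∀ u, u + 1 < 2 ^ h → x (w (lo + 2 * u + 1)) = false) :
    Circuit.run (andTree w h lo) x (w (lo + 2 ^ h - 1)) =
      decide (∀ u < 2 ^ h, x (w (lo + 2 * u)) = true) := by
  induction h generalizing lo x with
  | zero => simp [andTree]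
  | succ h ih =>
    have hpos : 0 < 2 ^ h := by positivity
    have e1 : 2 ^ (h + 1) = 2 * 2 ^ h := by ring
    have e2 : 2 ^ (h + 1 + 1) = 4 * 2 ^ h := by ring
    simp only [andTree, Circuit.run_append]
    set y := Circuit.run (andTree w h lo) x with hy
    set z := Circuit.run (andTree w h (lo + 2 ^ (h + 1))) y with hz
    have hyx : ∀ i, lo + 2 ^ (h + 1) ≤ i + 1 → i < N → y (w i) = x (w i) := fun i hi hiN => by
      refine Circuit.run_of_notMem _ _ fun hq => ?_
      obtain ⟨j, h1, h2, h3⟩ := mem_qubits_andTree hq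
      exact hw j i (by omega) hiN h3.symm
    have hzy : ∀ i, i < lo + 2 ^ (h + 1) → z (w i) = y (w i) := fun i hi => by
      refine Circuit.run_of_notMem _ _ fun hq => ?_
      obtain ⟨j, h1, h2, h3⟩ := mem_qubits_andTree hq
      exact hw i j (by omega) (by omega) h3
    have hL : y _ = _ := ih lo (by omega) x fun u hu => hx u (by omega)
    have hR : z _ = _ := ih (lo + 2 ^ (h + 1)) (by omega) y fun u hu => by
      rw [hyx _ (by omega) (by omega)]
      have := hx (u + 2 ^ h) (by omega)
      rwa [show lo + 2 * (u + 2 ^ h) + 1 = lo + 2 ^ (h + 1) + 2 * u + 1 by omega] at this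
    have hspare : x (w (lo + 2 ^ (h + 1) - 1)) = false := by
      have := hx (2 ^ h - 1) (by omega)
      rwa [show lo + 2 * (2 ^ h - 1) + 1 = lo + 2 ^ (h + 1) - 1 by omega] at this
    rw [run_tof (hw _ _ (by omega) (by omega)) (hw _ _ (by omega) (by omega))
      (hw _ _ (by omega) (by omega)).symm, Function.update_self, hzy _ (by omega),
      hyx _ (by omega) (by omega), hspare, hzy _ (by omega), hL, hR,
      Bool.false_xor, Bool.eq_iff_iff]
    simp only [Bool.and_eq_true, decide_eq_true_eq]
    constructor
    · rintro ⟨h1, h2⟩ u hu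
      rcases lt_or_ge u (2 ^ h) with h' | h'
      · exact h1 u h'
      · have := h2 (u - 2 ^ h) (by omega)
        rwa [hyx _ (by omega) (by omega),
          show lo + 2 ^ (h + 1) + 2 * (u - 2 ^ h) = lo + 2 * u by omega] at this
    · refine fun h' => ⟨fun u hu => h' u (by omega), fun u hu => ?_⟩
      rw [hyx _ (by omega) (by omega)]
      have := h' (u + 2 ^ h) (by omega)
      rwa [show lo + 2 * (u + 2 ^ h) = lo + 2 ^ (h + 1) + 2 * u by omega] at this

theorem fits_andTree {w : ℕ → Q} {N : ℕ} (hw : ∀ i j, i < j → j < N → w i ≠ w j) (h lo : ℕ)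
    (hN : lo + 2 ^ (h + 1) ≤ N) : Fits (andTree w h lo) h (2 ^ h - 1) := by
  induction h generalizing lo with
  | zero => exact Fits.nil _ _
  | succ h ih =>
    have hpos : 0 < 2 ^ h := by positivity
    have e1 : 2 ^ (h + 1) = 2 * 2 ^ h := by ring
    have e2 : 2 ^ (h + 1 + 1) = 4 * 2 ^ h := by ring
    refine (((ih lo (by omega)).parallel (ih (lo + 2 ^ (h + 1)) (by omega)) ?_).append
      (fits_tof _ _ _)).mono le_rfl (by omega)
    refine Set.disjoint_left.2 fun q hq hq' => ?_
    obtain ⟨i, h1, h2, h3⟩ := mem_qubits_andTree hq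
    obtain ⟨j, k1, k2, k3⟩ := mem_qubits_andTree hq'
    exact hw i j (by omega) (by omega) (h3.symm.trans k3)

/-- For `v = 1, …, n`, add the product of the bits of `w (4 v), …, w (4 v + 3)` to `w (2 v)`. -/
def quadCircuit (w e : ℕ → Q) (n : ℕ) : Circuit Q :=
  (List.range n).flatMap fun i =>
    mcxDirty 1 (fun j => w (4 * (i + 1) + j)) (fun j => e (2 * (i + 1) + j)) (w (2 * (i + 1)))

/-- `w 0, …, w (N - 1)`, `e 0, …, e (N - 2)`, `s` and `t` are different qubits. -/
structure DistinctWires (N : ℕ) (w e : ℕ → Q) (s t : Q) : Prop where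
  w_ne : ∀ i j, i < j → j < N → w i ≠ w j
  e_ne : ∀ i j, i < j → j + 1 < N → e i ≠ e j
  w_ne_e : ∀ i < N, ∀ j, j + 1 < N → w i ≠ e j
  w_ne_s : ∀ i < N, w i ≠ s
  w_ne_t : ∀ i < N, w i ≠ t
  e_ne_s : ∀ i, i + 1 < N → e i ≠ s
  e_ne_t : ∀ i, i + 1 < N → e i ≠ t
  s_ne_t : s ≠ t

variable {N : ℕ} {w e : ℕ → Q} {s t : Q}

theorem run_quadCircuit (hd : DistinctWires N w e s t) {n : ℕ} (hn : 4 * n + 3 < N)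
    (x : Q → Bool) :
    (∀ q, (∀ i < n, q ≠ w (2 * (i + 1))) → Circuit.run (quadCircuit w e n) x q = x q) ∧
    ∀ i < n, Circuit.run (quadCircuit w e n) x (w (2 * (i + 1))) =
      xor (x (w (2 * (i + 1)))) (decide (∀ j ≤ 1 + 2, x (w (4 * (i + 1) + j)) = true)) := by
  refine Circuit.run_flatMap_toggle
    (g := fun i x => decide (∀ j ≤ 1 + 2, x (w (4 * (i + 1) + j)) = true))
    (fun i hi x => run_mcxDirty (j := 1) (c := fun j => w (4 * (i + 1) + j))
      (d := fun j => e (2 * (i + 1) + j)) (hd.w_ne _ _ (by omega) (by omega))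
      (fun a b hab hb => hd.e_ne _ _ (by omega) (by omega))
      (fun a ha b hb => hd.w_ne_e _ (by omega) _ (by omega))
      (fun a ha => (hd.w_ne (2 * (i + 1)) (4 * (i + 1) + a) (by omega) (by omega)).symm)
      (fun a ha => (hd.w_ne_e _ (by omega) _ (by omega)).symm) x)
    (fun i j hi hj => hd.w_ne _ _ (by omega) (by omega)) (fun i hi x y hxy => ?_) x
  congr 1
  simp only [eq_iff_iff]
  exact forall₂_congr fun j hj => by
    rw [hxy _ fun k hk => (hd.w_ne _ _ (by omega) (by omega)).symm]

theorem mem_qubits_quad {i : ℕ} {q : Q} (h : q ∈ Circuit.qubits (mcxDirty 1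
    (fun j => w (4 * (i + 1) + j)) (fun j => e (2 * (i + 1) + j)) (w (2 * (i + 1))))) :
    (∃ j ≤ 3, q = w (4 * (i + 1) + j)) ∨ (∃ j ≤ 1, q = e (2 * (i + 1) + j)) ∨
      q = w (2 * (i + 1)) :=
  mem_qubits_mcxDirty h

theorem fits_quadCircuit (hd : DistinctWires N w e s t) {r : ℕ} (hr : 2 ^ (r + 2) ≤ N) :
    Fits (quadCircuit w e (2 ^ r - 1)) (8 * r) (8 * 2 ^ r) := by
  induction r with
  | zero => exact Fits.nil _ _
  | succ r ih =>
    have hpos : 0 < 2 ^ r := by positivity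
    have e1 : 2 ^ (r + 1) = 2 * 2 ^ r := by ring
    have e2 : 2 ^ (r + 2) = 4 * 2 ^ r := by ring
    have e3 : 2 ^ (r + 1 + 2) = 8 * 2 ^ r := by ring
    rw [quadCircuit, show 2 ^ (r + 1) - 1 = 2 ^ r - 1 + 2 ^ r by omega, List.range_add,
      List.flatMap_append, List.flatMap_map]
    have hlayer := Fits.flatMap_range (n := 2 ^ r) (d := 8) (s := fun _ => 8)
      (f := fun i => mcxDirty 1 (fun j => w (4 * (2 ^ r - 1 + i + 1) + j))
        (fun j => e (2 * (2 ^ r - 1 + i + 1) + j)) (w (2 * (2 ^ r - 1 + i + 1))))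
      (fun i _ => fits_mcxDirty 1 _ _ _) fun i j hij hj => Set.disjoint_left.2 fun q hq hq' => by
        rcases mem_qubits_quad hq with ⟨a, ha, h⟩ | ⟨a, ha, h⟩ | h <;>
        rcases mem_qubits_quad hq' with ⟨b, hb, h'⟩ | ⟨b, hb, h'⟩ | h'
        · exact hd.w_ne _ _ (by omega) (by omega) (h.symm.trans h')
        · exact hd.w_ne_e _ (by omega) _ (by omega) (h.symm.trans h')
        · exact hd.w_ne _ _ (by omega) (by omega) (h'.symm.trans h)
        · exact hd.w_ne_e _ (by omega) _ (by omega) (h'.symm.trans h)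
        · exact hd.e_ne _ _ (by omega) (by omega) (h.symm.trans h')
        · exact hd.w_ne_e _ (by omega) _ (by omega) (h'.symm.trans h)
        · exact hd.w_ne _ _ (by omega) (by omega) (h.symm.trans h')
        · exact hd.w_ne_e _ (by omega) _ (by omega) (h.symm.trans h')
        · exact hd.w_ne _ _ (by omega) (by omega) (h.symm.trans h')
    exact ((ih (by omega)).append hlayer).mono (by omega) (by simp; omega)

/-- The preparation of the product of `2 ^ (r + 2)` bits, given a qubit `a`. If the bits of `a`,
`w 2` and `w 3` are `1`, then afterwards the roots of the trees at `w (2 ^ (k + 1) + 2 ^ k - 1)`,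
`k < r`, have product one if and only if all the bits of `w 2, w 3, …` were. -/
def prepCircuit (w e : ℕ → Q) (a : Q) (r : ℕ) : Circuit Q :=
  quadCircuit w e (2 ^ r - 1) ++ fanOutCircuit a (fun i => w (i + 2)) (2 ^ (r + 1) - 2) ++
    (List.range r).flatMap fun k => andTree w k (2 ^ (k + 1))

/-- The qubits whose product is to be taken after the preparation. -/
def rootWires (w : ℕ → Q) (a s : Q) : ℕ → Q
  | 0 => a
  | 1 => s
  | 2 => w 0
  | 3 => w 1
  | k + 4 => w (2 ^ (k + 1) + 2 ^ k - 1)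

theorem two_pow_succ_add_le {k r : ℕ} (hk : k < r) :
    2 ^ (k + 1) + 2 ^ (k + 1) ≤ 2 ^ (r + 1) := by
  calc 2 ^ (k + 1) + 2 ^ (k + 1) = 2 ^ (k + 2) := by ring
    _ ≤ 2 ^ (r + 1) := Nat.pow_le_pow_right (by norm_num) (by omega)

theorem mem_qubits_prepCircuit {r : ℕ} {a q : Q}
    (h : q ∈ Circuit.qubits (prepCircuit w e a r)) :
    (∃ i, 2 ≤ i ∧ i < 2 ^ (r + 2) ∧ q = w i) ∨ (∃ j < 2 ^ (r + 1), q = e j) ∨ q = a := by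
  have hpos : 0 < 2 ^ r := by positivity
  have e1 : 2 ^ (r + 1) = 2 * 2 ^ r := by ring
  have e2 : 2 ^ (r + 2) = 4 * 2 ^ r := by ring
  simp only [prepCircuit, Circuit.qubits_append, Set.mem_union] at h
  rcases h with (h | h) | h
  · obtain ⟨i, hi, h⟩ := Circuit.mem_qubits_flatMap.1 h
    rw [List.mem_range] at hi
    rcases mem_qubits_quad h with ⟨j, hj, h⟩ | ⟨j, hj, h⟩ | h
    exacts [.inl ⟨_, by omega, by omega, h⟩, .inr (.inl ⟨_, by omega, h⟩),
      .inl ⟨_, by omega, by omega, h⟩]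
  · rcases mem_qubits_fanOutCircuit h with h | ⟨i, hi, h⟩
    exacts [.inr (.inr h), .inl ⟨_, by omega, by omega, h⟩]
  · obtain ⟨k, hk, h⟩ := Circuit.mem_qubits_flatMap.1 h
    obtain ⟨i, h1, h2, h3⟩ := mem_qubits_andTree h
    have := two_pow_succ_add_le (List.mem_range.1 hk)
    have : 0 < 2 ^ k := by positivity
    have : 2 ^ (k + 1) = 2 * 2 ^ k := by ring
    exact .inl ⟨i, by omega, by omega, h3⟩

theorem fits_prepCircuit {r : ℕ} {a : Q} (hd : DistinctWires N w e s t) (hr : 2 ^ (r + 2) ≤ N) :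
    Fits (prepCircuit w e a r) (13 * r + 5) (25 * 2 ^ r) := by
  have hpos : 0 < 2 ^ r := by positivity
  have e1 : 2 ^ (r + 1) = 2 * 2 ^ r := by ring
  have e2 : 2 ^ (r + 2) = 4 * 2 ^ r := by ring
  have hfan : Fits (fanOutCircuit a (fun i => w (i + 2)) (2 ^ (r + 1) - 2)) (4 * (r + 1) + 1)
      (16 * 2 ^ r) := by
    have hs : Nat.size (2 ^ (r + 1) - 2) ≤ r + 1 := Nat.size_le.2 (by omega)
    exact (fits_fanOutCircuit fun i j hi hj => hd.w_ne _ _ (by omega) (by omega)).mono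
      (by omega) (by omega)
  have htree : Fits ((List.range r).flatMap fun k => andTree w k (2 ^ (k + 1))) r (2 ^ r) := by
    have hsz : ∑ k ∈ Finset.range r, (2 ^ k - 1) ≤ 2 ^ r :=
      (Finset.sum_le_sum fun k _ => Nat.sub_le _ _).trans
        (by rw [Nat.geomSum_eq le_rfl]; omega)
    refine (Fits.flatMap_range (fun k hk => ?_) fun i j hij hj => ?_).mono le_rfl hsz
    · have := two_pow_succ_add_le hk
      exact (fits_andTree hd.w_ne k _ (by omega)).mono hk.le le_rfl
    · refine Set.disjoint_left.2 fun q hq hq' => ?_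
      obtain ⟨k, h1, h2, h3⟩ := mem_qubits_andTree hq
      obtain ⟨l, k1, k2, k3⟩ := mem_qubits_andTree hq'
      have := two_pow_succ_add_le hij
      have := two_pow_succ_add_le hj
      exact hd.w_ne k l (by omega) (by omega) (h3.symm.trans k3)
  exact (((fits_quadCircuit hd hr).append hfan).append htree).mono (by omega) (by omega)

theorem run_prepCircuit_of_ne {r : ℕ} {a : Q} (hd : DistinctWires N w e s t)
    (hr : 2 ^ (r + 2) ≤ N) (ha : ∀ i < N, w i ≠ a) (x : Q → Bool) {q : Q}
    (hq : ∀ i, 2 ≤ i → i < N → q ≠ w i) :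
    Circuit.run (prepCircuit w e a r) x q = x q := by
  have hpos : 0 < 2 ^ r := by positivity
  have e1 : 2 ^ (r + 1) = 2 * 2 ^ r := by ring
  have e2 : 2 ^ (r + 2) = 4 * 2 ^ r := by ring
  simp only [prepCircuit, Circuit.run_append]
  rw [Circuit.run_of_notMem _ _ ?_, (run_fanOutCircuit (fun i j hi hj => hd.w_ne _ _ (by omega)
    (by omega)) (fun i hi => (ha _ (by omega)).symm) _).1 q fun i hi => hq _ (by omega) (by omega),
    (run_quadCircuit hd (by omega) x).1 q fun i hi => hq _ (by omega) (by omega)]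
  intro h
  obtain ⟨k, hk, h⟩ := Circuit.mem_qubits_flatMap.1 h
  obtain ⟨i, h1, h2, h3⟩ := mem_qubits_andTree h
  have := two_pow_succ_add_le (List.mem_range.1 hk)
  have : 0 < 2 ^ k := by positivity
  have : 2 ^ (k + 1) = 2 * 2 ^ k := by ring
  exact hq i (by omega) (by omega) h3

/-- If the bits of `a` and of `w i` for `2 ≤ i < 2 ^ (k + 2)` are `1`, then the inner nodes of the
`k`-th tree start from `0`, and its leaves hold the products of four bits each of the next
level. -/
theorem run_prepCircuit_root {r k : ℕ} {a : Q} (hd : DistinctWires N w e s t)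
    (hr : 2 ^ (r + 2) ≤ N) (hk : k < r) (ha : ∀ i < N, w i ≠ a) {x : Q → Bool} (hxa : x a = true)
    (hx : ∀ i, 2 ≤ i → i < 2 ^ (k + 2) → x (w i) = true) :
    Circuit.run (prepCircuit w e a r) x (w (2 ^ (k + 1) + 2 ^ k - 1)) = true ↔
      ∀ i, 2 ≤ i → i < 2 ^ (k + 3) → x (w i) = true := by
  have hpos : 0 < 2 ^ k := by positivity
  have e0 : 2 ^ (k + 1) = 2 * 2 ^ k := by ring
  have e3 : 2 ^ (k + 2) = 4 * 2 ^ k := by ring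
  have e4 : 2 ^ (k + 3) = 8 * 2 ^ k := by ring
  have e1 : 2 ^ (r + 1) = 2 * 2 ^ r := by ring
  have e2 : 2 ^ (r + 2) = 4 * 2 ^ r := by ring
  have hkr : 2 * 2 ^ k ≤ 2 ^ r := by
    have := two_pow_succ_add_le hk
    omega
  simp only [prepCircuit, Circuit.run_append]
  obtain ⟨y1, y2⟩ := run_quadCircuit hd (n := 2 ^ r - 1) (by omega) x
  set y := Circuit.run (quadCircuit w e (2 ^ r - 1)) x
  obtain ⟨z1, z2⟩ := run_fanOutCircuit (c := a) (w := fun i => w (i + 2)) (m := 2 ^ (r + 1) - 2)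
    (fun i j hi hj => hd.w_ne _ _ (by omega) (by omega)) (fun i hi => (ha _ (by omega)).symm) y
  set z := Circuit.run (fanOutCircuit a (fun i => w (i + 2)) (2 ^ (r + 1) - 2)) y
  have hya : y a = true := by rw [y1 a fun i hi => (ha _ (by omega)).symm, hxa]
  have hz : ∀ i, 2 ≤ i → i < 2 ^ (r + 1) → z (w i) = !y (w i) := fun i hi hi' => by
    have := z2 (i - 2) (by omega)
    simp only [Nat.sub_add_cancel hi] at this
    rw [this, hya, Bool.xor_true]
  rw [Circuit.run_flatMap_disjoint
    (S := fun k => {q | ∃ i, 2 ^ (k + 1) ≤ i ∧ i < 2 ^ (k + 2) ∧ q = w i}) ?_ ?_ _ k hk _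
    ⟨_, by omega, by omega, rfl⟩, run_andTree hd.w_ne k _ (by omega), decide_eq_true_eq]
  · have hleaf : ∀ u < 2 ^ k, z (w (2 ^ (k + 1) + 2 * u)) = true ↔
        ∀ j ≤ 1 + 2, x (w (2 ^ (k + 2) + 4 * u + j)) = true := fun u hu => by
      have := y2 (2 ^ k + u - 1) (by omega)
      rw [show 2 * (2 ^ k + u - 1 + 1) = 2 ^ (k + 1) + 2 * u by omega,
        show 4 * (2 ^ k + u - 1 + 1) = 2 ^ (k + 2) + 4 * u by omega] at this
      rw [hz _ (by omega) (by omega), this, hx _ (by omega) (by omega)]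
      simp
    constructor
    · intro h i hi hi'
      rcases lt_or_ge i (2 ^ (k + 2)) with h' | h'
      · exact hx i hi h'
      · have := (hleaf ((i - 2 ^ (k + 2)) / 4) (by omega)).1 (h _ (by omega))
          ((i - 2 ^ (k + 2)) % 4) (by omega)
        rwa [show 2 ^ (k + 2) + 4 * ((i - 2 ^ (k + 2)) / 4) + (i - 2 ^ (k + 2)) % 4 = i
          by omega] at this
    · exact fun h u hu => (hleaf u hu).2 fun j hj => h _ (by omega) (by omega)
  · intro u hu
    rw [hz _ (by omega) (by omega), y1 _ fun i hi => ?_, hx _ (by omega) (by omega)]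
    · rfl
    · rcases Nat.lt_or_gt_of_ne (show 2 ^ (k + 1) + 2 * u + 1 ≠ 2 * (i + 1) by omega) with h | h
      exacts [hd.w_ne _ _ h (by omega), (hd.w_ne _ _ h (by omega)).symm]
  · intro i hi q hq
    obtain ⟨j, h1, h2, h3⟩ := mem_qubits_andTree hq
    exact ⟨j, h1, by rw [pow_succ 2 (i + 1)]; omega, h3⟩
  · intro i j hij hj
    refine Set.disjoint_left.2 ?_
    rintro q ⟨a, h1, h2, h3⟩ ⟨b, k1, k2, k3⟩
    have := two_pow_succ_add_le hij
    have := two_pow_succ_add_le hj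
    have : 2 ^ (i + 2) = 2 * 2 ^ (i + 1) := by ring
    have : 2 ^ (j + 2) = 2 * 2 ^ (j + 1) := by ring
    exact hd.w_ne a b (by omega) (by omega) (h3.symm.trans k3)

end LogMCX

/-! ### Multi-controlled X gates in logarithmic depth from dirty qubits -/

section LogMCX

variable {Q : Type} [DecidableEq Q] {w e : ℕ → Q} {a s t : Q}

/-- Add to `t` the product of the bits of `rootWires w a s` after the preparation, and undo the
preparation. -/
def condMCX (w e : ℕ → Q) (a s t : Q) (r : ℕ) : Circuit Q :=
  prepCircuit w e a r ++ mcxDirty (r + 1) (rootWires w a s) e t ++ (prepCircuit w e a r).reverse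

/-- The X gate on `t` controlled by `s` and `w 0, …, w (2 ^ ℓ - 1)`, with the help of the qubits
`e 0, …, e (2 ^ ℓ - 2)` in arbitrary states, which are restored. For `ℓ ≥ 2`, one of the latter
is toggled by the product of the bits of `w 2` and `w 3`, so that if this product is `1`, exactly
one of the two copies of `condMCX` sees the bit `1` there. -/
def logMCX (w e : ℕ → Q) (s t : Q) : ℕ → Circuit Q
  | 0 => tof s (w 0) t
  | 1 => mcxDirty 0 (fun j => if j = 0 then s else w (j - 1)) e t
  | r + 2 => condMCX w e (e (2 ^ (r + 2) - 2)) s t r ++ tof (w 2) (w 3) (e (2 ^ (r + 2) - 2)) ++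
      condMCX w e (e (2 ^ (r + 2) - 2)) s t r ++ tof (w 2) (w 3) (e (2 ^ (r + 2) - 2))

omit [DecidableEq Q] in
theorem rootWires_cases {r l : ℕ} (hl : l ≤ r + 1 + 2) :
    rootWires w a s l = a ∨ rootWires w a s l = s ∨
      ∃ i < 2 ^ (r + 2), rootWires w a s l = w i := by
  have hpos : 0 < 2 ^ r := by positivity
  have e2 : 2 ^ (r + 2) = 4 * 2 ^ r := by ring
  match l with
  | 0 => exact .inl rfl
  | 1 => exact .inr (.inl rfl)
  | 2 => exact .inr (.inr ⟨0, by omega, rfl⟩)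
  | 3 => exact .inr (.inr ⟨1, by omega, rfl⟩)
  | k + 4 =>
    have := two_pow_succ_add_le (show k < r by omega)
    have : 2 ^ (k + 1) = 2 * 2 ^ k := by ring
    have : 2 ^ (r + 1) = 2 * 2 ^ r := by ring
    have : 0 < 2 ^ k := by positivity
    exact .inr (.inr ⟨_, by omega, rfl⟩)

theorem run_condMCX {r : ℕ} (hd : DistinctWires (2 ^ (r + 2)) w e s t)
    (ha : a = e (2 ^ (r + 2) - 2)) (x : Q → Bool) :
    Circuit.run (condMCX w e a s t r) x = Function.update x t (xor (x t)
      (decide (∀ l ≤ r + 1 + 2,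
        Circuit.run (prepCircuit w e a r) x (rootWires w a s l) = true))) := by
  have hr : r < 2 ^ r := Nat.lt_two_pow_self
  have e1 : 2 ^ (r + 1) = 2 * 2 ^ r := by ring
  have e2 : 2 ^ (r + 2) = 4 * 2 ^ r := by ring
  have hat : a ≠ t := by rw [ha]; exact hd.e_ne_t _ (by omega)
  have ht : t ∉ Circuit.qubits (prepCircuit w e a r) := fun h => by
    rcases mem_qubits_prepCircuit h with ⟨i, h1, h2, h⟩ | ⟨j, hj, h⟩ | h
    exacts [hd.w_ne_t _ h2 h.symm, hd.e_ne_t _ (by omega) h.symm, hat h.symm]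
  simp only [condMCX, Circuit.run_append]
  rw [run_mcxDirty, Circuit.run_update_of_notMem _ _ _ (by simpa using ht),
    Circuit.run_reverse_run, Circuit.run_of_notMem _ _ ht]
  · rw [ha]
    exact hd.e_ne_s _ (by omega)
  · exact fun i j hij hj => hd.e_ne _ _ hij (by omega)
  · intro i hi j hj
    rcases rootWires_cases (w := w) (a := a) (s := s) hi with h | h | ⟨k, hk, h⟩ <;> rw [h]
    · rw [ha]
      exact (hd.e_ne _ _ (by omega) (by omega)).symm
    · exact (hd.e_ne_s _ (by omega)).symm
    · exact hd.w_ne_e _ hk _ (by omega)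
  · intro i hi
    rcases rootWires_cases (w := w) (a := a) (s := s) hi with h | h | ⟨k, hk, h⟩ <;> rw [h]
    exacts [hat, hd.s_ne_t, hd.w_ne_t _ hk]
  · exact fun i hi => hd.e_ne_t _ (by omega)

/-- If the bits of `w 2` and `w 3` are `1`, the product of the roots after the preparation is the
wanted product if the bit of `a` is `1`, and `0` if it is `0`. -/
theorem prod_rootWires {r : ℕ} (hd : DistinctWires (2 ^ (r + 2)) w e s t)
    (ha : a = e (2 ^ (r + 2) - 2)) {x : Q → Bool} (h2 : x (w 2) = true) (h3 : x (w 3) = true) :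
    (∀ l ≤ r + 1 + 2, Circuit.run (prepCircuit w e a r) x (rootWires w a s l) = true) ↔
      x a = true ∧ x s = true ∧ ∀ i < 2 ^ (r + 2), x (w i) = true := by
  have hpos : 0 < 2 ^ r := by positivity
  have e2 : 2 ^ (r + 2) = 4 * 2 ^ r := by ring
  have hwa : ∀ i < 2 ^ (r + 2), w i ≠ a := fun i hi => by
    rw [ha]; exact hd.w_ne_e _ hi _ (by omega)
  have hfix : ∀ q, (∀ i, 2 ≤ i → i < 2 ^ (r + 2) → q ≠ w i) →
      Circuit.run (prepCircuit w e a r) x q = x q := fun q hq =>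
    run_prepCircuit_of_ne hd le_rfl hwa x hq
  have hfa : Circuit.run (prepCircuit w e a r) x a = x a :=
    hfix a fun i _ hi => (hwa i hi).symm
  have hfs : Circuit.run (prepCircuit w e a r) x s = x s :=
    hfix s fun i _ hi => (hd.w_ne_s i hi).symm
  have hf0 : Circuit.run (prepCircuit w e a r) x (w 0) = x (w 0) :=
    hfix _ fun i hi hi' => hd.w_ne _ _ (by omega) hi'
  have hf1 : Circuit.run (prepCircuit w e a r) x (w 1) = x (w 1) :=
    hfix _ fun i hi hi' => hd.w_ne _ _ (by omega) hi'
  constructor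
  · intro h
    have hxa : x a = true := hfa ▸ h 0 (by omega)
    -- level by level, all bits are one
    have hall : ∀ k ≤ r, ∀ i, 2 ≤ i → i < 2 ^ (k + 2) → x (w i) = true := by
      intro k hk
      induction k with
      | zero =>
        intro i hi hi'
        obtain rfl | rfl : i = 2 ∨ i = 3 := by norm_num at hi'; omega
        exacts [h2, h3]
      | succ k ih =>
        exact (run_prepCircuit_root hd le_rfl hk hwa hxa (ih (by omega))).1 (h (k + 4) (by omega))
    refine ⟨hxa, hfs ▸ h 1 (by omega), fun i hi => ?_⟩
    match i with
    | 0 => exact hf0 ▸ h 2 (by omega)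
    | 1 => exact hf1 ▸ h 3 (by omega)
    | i + 2 => exact hall r le_rfl _ (by omega) hi
  · rintro ⟨hxa, hxs, h⟩ l hl
    match l with
    | 0 => exact hfa.trans hxa
    | 1 => exact hfs.trans hxs
    | 2 => exact hf0.trans (h 0 (by omega))
    | 3 => exact hf1.trans (h 1 (by omega))
    | k + 4 =>
      have hk : 2 ^ (k + 3) ≤ 2 ^ (r + 2) := Nat.pow_le_pow_right (by norm_num) (by omega)
      have hk' : 2 ^ (k + 2) ≤ 2 ^ (k + 3) := Nat.pow_le_pow_right (by norm_num) (by omega)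
      exact (run_prepCircuit_root hd le_rfl (by omega) hwa hxa
        fun i _ hi => h i (by omega)).2 fun i _ hi => h i (by omega)

theorem run_logMCX {ℓ : ℕ} (hd : DistinctWires (2 ^ ℓ) w e s t) (x : Q → Bool) :
    Circuit.run (logMCX w e s t ℓ) x =
      Function.update x t (xor (x t) (x s && decide (∀ i < 2 ^ ℓ, x (w i) = true))) := by
  match ℓ with
  | 0 =>
    rw [logMCX, run_tof (hd.w_ne_s 0 (by norm_num)).symm hd.s_ne_t (hd.w_ne_t 0 (by norm_num))]
    simp
  | 1 =>
    rw [logMCX, run_mcxDirty]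
    · congr 2
      rw [Bool.eq_iff_iff]
      simp only [Bool.and_eq_true, decide_eq_true_eq]
      constructor
      · exact fun h => ⟨h 0 (by omega), fun i hi => h (i + 1) (by omega)⟩
      · rintro ⟨h1, h2⟩ l hl
        match l with
        | 0 => exact h1
        | l + 1 => exact h2 l (by omega)
    · exact (hd.w_ne_s 0 (by norm_num)).symm
    · intro i j hij hj
      omega
    · intro i hi j hj
      obtain rfl : j = 0 := by omega
      split_ifs
      exacts [(hd.e_ne_s 0 (by norm_num)).symm, hd.w_ne_e _ (by omega) _ (by norm_num)]
    · intro i hi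
      split_ifs
      exacts [hd.s_ne_t, hd.w_ne_t _ (by omega)]
    · intro i hi
      exact hd.e_ne_t _ (by omega)
  | r + 2 =>
    have hpos : 0 < 2 ^ r := by positivity
    have e2 : 2 ^ (r + 2) = 4 * 2 ^ r := by ring
    simp only [logMCX, Circuit.run_append]
    obtain ⟨a, ha⟩ : ∃ a, a = e (2 ^ (r + 2) - 2) := ⟨_, rfl⟩
    rw [← ha]
    have hat : a ≠ t := by rw [ha]; exact hd.e_ne_t _ (by omega)
    have has : s ≠ a := by rw [ha]; exact (hd.e_ne_s _ (by omega)).symm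
    have hwa : ∀ i < 2 ^ (r + 2), w i ≠ a := fun i hi => by
      rw [ha]; exact hd.w_ne_e _ hi _ (by omega)
    have hw2 := hwa 2 (by omega)
    have hw3 := hwa 3 (by omega)
    have hT := run_tof (hd.w_ne 2 3 (by omega) (by omega)) hw2 hw3
    -- the product of the roots does not depend on `t`
    set φ : (Q → Bool) → Bool := fun x => decide (∀ l ≤ r + 1 + 2,
      Circuit.run (prepCircuit w e a r) x (rootWires w a s l) = true) with hφ
    have ht : t ∉ Circuit.qubits (prepCircuit w e a r) := fun h => by
      rcases mem_qubits_prepCircuit h with ⟨i, h1, h2, h⟩ | ⟨j, hj, h⟩ | h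
      exacts [hd.w_ne_t _ h2 h.symm,
        hd.e_ne_t _ (by rw [pow_succ 2 (r + 1)]; omega) h.symm, hat h.symm]
    have hφt : ∀ x b, φ (Function.update x t b) = φ x := fun x b => by
      simp only [hφ]
      congr 1
      simp only [eq_iff_iff]
      refine forall₂_congr fun l hl => ?_
      rw [Circuit.run_update_of_notMem _ _ _ ht, Function.update_of_ne]
      rcases rootWires_cases (w := w) (a := a) (s := s) hl with h | h | ⟨k, hk, h⟩ <;> rw [h]
      exacts [hat, hd.s_ne_t, hd.w_ne_t _ hk]
    have hE : ∀ x, Circuit.run (condMCX w e a s t r) x =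
        Function.update x t (xor (x t) (φ x)) := fun x => run_condMCX hd ha x
    have hrun : Circuit.run (tof (w 2) (w 3) a) (Circuit.run (condMCX w e a s t r)
        (Circuit.run (tof (w 2) (w 3) a) (Circuit.run (condMCX w e a s t r) x))) =
        Function.update x t (xor (x t) (xor (φ x)
          (φ (Function.update x a (xor (x a) (x (w 2) && x (w 3))))))) := by
      have hw2t := hd.w_ne_t 2 (by omega)
      have hw3t := hd.w_ne_t 3 (by omega)
      set v := xor (x a) (x (w 2) && x (w 3)) with hv
      have hvv : xor v (x (w 2) && x (w 3)) = x a := by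
        rw [hv, Bool.xor_assoc, Bool.xor_self, Bool.xor_false]
      have h1 : ∀ b, Circuit.run (tof (w 2) (w 3) a) (Function.update x t b) =
          Function.update (Function.update x a v) t b := fun b => by
        rw [hT, Function.update_comm hat.symm, Function.update_of_ne hat,
          Function.update_of_ne hw2t, Function.update_of_ne hw3t]
      rw [hE x, h1, hE, hφt, Function.update_self, Function.update_idem, hT,
        Function.update_of_ne hat, Function.update_of_ne hw2t, Function.update_of_ne hw3t,
        Function.update_self, Function.update_of_ne hw2, Function.update_of_ne hw3,
        Function.update_comm hat, Function.update_idem, hvv, Function.update_comm hat.symm,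
        Function.update_eq_self, Bool.xor_assoc]
    rw [hrun]
    congr 2
    by_cases h : x (w 2) = true ∧ x (w 3) = true
    · obtain ⟨h2, h3⟩ := h
      have k1 := prod_rootWires hd ha h2 h3
      have k2 := prod_rootWires hd ha (x := Function.update x a (xor (x a) (x (w 2) && x (w 3))))
        (by rwa [Function.update_of_ne hw2]) (by rwa [Function.update_of_ne hw3])
      have k3 : (∀ i < 2 ^ (r + 2),
          Function.update x a (xor (x a) (x (w 2) && x (w 3))) (w i) = true) ↔
          ∀ i < 2 ^ (r + 2), x (w i) = true :=
        forall₂_congr fun i hi => by rw [Function.update_of_ne (hwa i hi)]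
      rw [Function.update_self, k3, Function.update_of_ne has, h2, h3] at k2
      rw [hφ]
      simp only [h2, h3, k1, k2]
      cases x a <;> simp
    · have hp : (x (w 2) && x (w 3)) = false := by
        rwa [← Bool.not_eq_true, Bool.and_eq_true]
      have hn : ¬ ∀ i < 2 ^ (r + 2), x (w i) = true := fun hall =>
        h ⟨hall 2 (by omega), hall 3 (by omega)⟩
      rw [hp, Bool.xor_false, Function.update_eq_self, Bool.xor_self, decide_eq_false hn,
        Bool.and_false]

theorem fits_logMCX {ℓ : ℕ} (hd : DistinctWires (2 ^ ℓ) w e s t) :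
    Fits (logMCX w e s t ℓ) (60 * ℓ + 4) (32 * 2 ^ ℓ) := by
  match ℓ with
  | 0 => exact (fits_tof _ _ _).mono (by omega) (by omega)
  | 1 =>
    rw [logMCX]
    exact (fits_mcxDirty _ _ _ _).mono (by omega) (by omega)
  | r + 2 =>
    have hr : r < 2 ^ r := Nat.lt_two_pow_self
    have e2 : 2 ^ (r + 2) = 4 * 2 ^ r := by ring
    have hW := fits_prepCircuit (a := e (2 ^ (r + 2) - 2)) hd le_rfl
    have hE : Fits (condMCX w e (e (2 ^ (r + 2) - 2)) s t r) (30 * r + 18)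
        (50 * 2 ^ r + 4 * r + 8) :=
      ((hW.append (fits_mcxDirty _ _ _ _)).append hW.reverse).mono (by omega) (by omega)
    exact (((hE.append (fits_tof _ _ _)).append hE).append (fits_tof _ _ _)).mono
      (by omega) (by omega)

theorem mem_qubits_logMCX {ℓ : ℕ} {q : Q} (h : q ∈ Circuit.qubits (logMCX w e s t ℓ)) :
    (∃ i < 2 ^ ℓ, q = w i) ∨ (∃ j, j + 1 < 2 ^ ℓ ∧ q = e j) ∨ q = s ∨ q = t := by
  match ℓ with
  | 0 =>
    rw [logMCX] at h
    rcases qubits_tof_subset _ _ _ h with h | h | h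
    exacts [.inr (.inr (.inl h)), .inl ⟨0, by norm_num, h⟩, .inr (.inr (.inr h))]
  | 1 =>
    rw [logMCX] at h
    rcases mem_qubits_mcxDirty h with ⟨l, hl, h⟩ | ⟨l, hl, h⟩ | h
    · split_ifs at h
      exacts [.inr (.inr (.inl h)), .inl ⟨_, by omega, h⟩]
    · exact .inr (.inl ⟨l, by omega, h⟩)
    · exact .inr (.inr (.inr h))
  | r + 2 =>
    have hr : r < 2 ^ r := Nat.lt_two_pow_self
    have e1 : 2 ^ (r + 1) = 2 * 2 ^ r := by ring
    have e2 : 2 ^ (r + 2) = 4 * 2 ^ r := by ring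
    have hT : q ∈ Circuit.qubits (tof (w 2) (w 3) (e (2 ^ (r + 2) - 2))) →
        (∃ i < 2 ^ (r + 2), q = w i) ∨ (∃ j, j + 1 < 2 ^ (r + 2) ∧ q = e j) ∨
          q = s ∨ q = t := fun h => by
      rcases qubits_tof_subset _ _ _ h with h | h | h
      exacts [.inl ⟨_, by omega, h⟩, .inl ⟨_, by omega, h⟩, .inr (.inl ⟨_, by omega, h⟩)]
    have hW : q ∈ Circuit.qubits (prepCircuit w e (e (2 ^ (r + 2) - 2)) r) →
        (∃ i < 2 ^ (r + 2), q = w i) ∨ (∃ j, j + 1 < 2 ^ (r + 2) ∧ q = e j) ∨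
          q = s ∨ q = t := fun h => by
      rcases mem_qubits_prepCircuit h with ⟨i, h1, h2, h⟩ | ⟨j, hj, h⟩ | h
      exacts [.inl ⟨_, h2, h⟩, .inr (.inl ⟨_, by omega, h⟩), .inr (.inl ⟨_, by omega, h⟩)]
    have hE : q ∈ Circuit.qubits (condMCX w e (e (2 ^ (r + 2) - 2)) s t r) →
        (∃ i < 2 ^ (r + 2), q = w i) ∨ (∃ j, j + 1 < 2 ^ (r + 2) ∧ q = e j) ∨
          q = s ∨ q = t := fun h => by
      simp only [condMCX, Circuit.qubits_append, Circuit.qubits_reverse, Set.mem_union] at h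
      rcases h with (h | h) | h
      · exact hW h
      · rcases mem_qubits_mcxDirty h with ⟨l, hl, h⟩ | ⟨l, hl, h⟩ | h
        · rcases rootWires_cases (w := w) (a := e (2 ^ (r + 2) - 2)) (s := s) hl with
            h' | h' | ⟨k, hk, h'⟩
          exacts [.inr (.inl ⟨_, by omega, h.trans h'⟩), .inr (.inr (.inl (h.trans h'))),
            .inl ⟨k, hk, h.trans h'⟩]
        · exact .inr (.inl ⟨l, by omega, h⟩)
        · exact .inr (.inr (.inr h))
      · exact hW h
    rw [logMCX] at h
    simp only [Circuit.qubits_append, Set.mem_union] at h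
    rcases h with ((h | h) | h) | h
    exacts [hE h, hT h, hE h, hT h]

end LogMCX

/-! ### The carry ladder -/

section CarryLadder

variable {Q : Type} [DecidableEq Q] {T P : ℕ → Q} {m : ℕ}

/-- The circuit `T (j + 1) ↦ T (j + 1) ⊕ P (j + 1) · T j`, with the new value of `T j` on the
right. A step from `T (j 2^ℓ)` to `T ((j + 1) 2^ℓ)` borrows the qubits `T i` in between. -/
def carryLadder (T P : ℕ → Q) (m : ℕ) : Circuit Q :=
  ladderCircuit (fun ℓ j => logMCX (fun i => P (j * 2 ^ ℓ + 1 + i)) (fun i => T (j * 2 ^ ℓ + 1 + i))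
    (T (j * 2 ^ ℓ)) (T ((j + 1) * 2 ^ ℓ)) ℓ) m (Nat.size m) 0

omit [DecidableEq Q] in
theorem distinctWires_block (hT : ∀ i j, i < j → j ≤ m → T i ≠ T j)
    (hP : ∀ i j, 0 < i → i < j → j ≤ m → P i ≠ P j)
    (hTP : ∀ i ≤ m, ∀ j, 0 < j → j ≤ m → T i ≠ P j) {ℓ j : ℕ} (hj : (j + 1) * 2 ^ ℓ ≤ m) :
    DistinctWires (2 ^ ℓ) (fun i => P (j * 2 ^ ℓ + 1 + i)) (fun i => T (j * 2 ^ ℓ + 1 + i))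
      (T (j * 2 ^ ℓ)) (T ((j + 1) * 2 ^ ℓ)) := by
  have hpos : 0 < 2 ^ ℓ := by positivity
  rw [Nat.succ_mul] at hj ⊢
  constructor
  · exact fun a b hab hb => hP _ _ (by omega) (by omega) (by omega)
  · exact fun a b hab hb => hT _ _ (by omega) (by omega)
  · exact fun a ha b hb => (hTP _ (by omega) _ (by omega) (by omega)).symm
  · exact fun a ha => (hTP _ (by omega) _ (by omega) (by omega)).symm
  · exact fun a ha => (hTP _ (by omega) _ (by omega) (by omega)).symm
  · exact fun a ha => (hT _ _ (by omega) (by omega)).symm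
  · exact fun a ha => hT _ _ (by omega) (by omega)
  · exact hT _ _ (by omega) (by omega)

theorem mem_qubits_block {ℓ j : ℕ} {q : Q} (h : q ∈ Circuit.qubits
      (logMCX (fun i => P (j * 2 ^ ℓ + 1 + i)) (fun i => T (j * 2 ^ ℓ + 1 + i))
        (T (j * 2 ^ ℓ)) (T ((j + 1) * 2 ^ ℓ)) ℓ)) :
    (∃ i, j * 2 ^ ℓ ≤ i ∧ i ≤ (j + 1) * 2 ^ ℓ ∧ q = T i) ∨
      ∃ i, j * 2 ^ ℓ < i ∧ i ≤ (j + 1) * 2 ^ ℓ ∧ q = P i := by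
  have hpos : 0 < 2 ^ ℓ := by positivity
  rcases mem_qubits_logMCX h with ⟨i, hi, h⟩ | ⟨i, hi, h⟩ | h | h
  · exact .inr ⟨_, by omega, by rw [Nat.succ_mul]; omega, h⟩
  · exact .inl ⟨_, by omega, by rw [Nat.succ_mul]; omega, h⟩
  · exact .inl ⟨_, le_rfl, Nat.mul_le_mul_right _ (by omega), h⟩
  · exact .inl ⟨_, Nat.mul_le_mul_right _ (by omega), le_rfl, h⟩

theorem isCarryFamily_logMCX (hT : ∀ i j, i < j → j ≤ m → T i ≠ T j)
    (hP : ∀ i j, 0 < i → i < j → j ≤ m → P i ≠ P j)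
    (hTP : ∀ i ≤ m, ∀ j, 0 < j → j ≤ m → T i ≠ P j) :
    IsCarryFamily T (fun i x => x (P i)) m fun ℓ j =>
      logMCX (fun i => P (j * 2 ^ ℓ + 1 + i)) (fun i => T (j * 2 ^ ℓ + 1 + i))
        (T (j * 2 ^ ℓ)) (T ((j + 1) * 2 ^ ℓ)) ℓ where
  T_ne := hT
  p_congr i hi hi' x y hxy := hxy _ fun j hj => (hTP j hj i hi hi').symm
  run_blk ℓ j x hj := by
    rw [run_logMCX (distinctWires_block hT hP hTP hj)]
    congr 3
    rw [prodBits, decide_eq_decide]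
    constructor
    · intro h i hi
      rw [Finset.mem_Ioc, Nat.succ_mul] at hi
      have := h (i - (j * 2 ^ ℓ + 1)) (by omega)
      rwa [Nat.add_sub_cancel' (by omega)] at this
    · intro h i hi
      exact h _ (by rw [Finset.mem_Ioc, Nat.succ_mul]; omega)
  disjoint ℓ j j' hjj' hj' := by
    have h1 : (j + 1) * 2 ^ ℓ < j' * 2 ^ ℓ :=
      Nat.mul_lt_mul_of_pos_right (by omega) (by positivity)
    refine Set.disjoint_left.2 fun q hq hq' => ?_
    rcases mem_qubits_block hq with ⟨a, h2, h3, h⟩ | ⟨a, h2, h3, h⟩ <;>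
    rcases mem_qubits_block hq' with ⟨b, k2, k3, k⟩ | ⟨b, k2, k3, k⟩
    · exact hT a b (by omega) (by omega) (h.symm.trans k)
    · exact hTP a (by omega) b (by omega) (by omega) (h.symm.trans k)
    · exact hTP b (by omega) a (by omega) (by omega) (k.symm.trans h)
    · exact hP a b (by omega) (by omega) (by omega) (h.symm.trans k)

theorem run_carryLadder (hT : ∀ i j, i < j → j ≤ m → T i ≠ T j)
    (hP : ∀ i j, 0 < i → i < j → j ≤ m → P i ≠ P j)
    (hTP : ∀ i ≤ m, ∀ j, 0 < j → j ≤ m → T i ≠ P j) (x : Q → Bool) :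
    (∀ q, (∀ j < m, q ≠ T (j + 1)) → Circuit.run (carryLadder T P m) x q = x q) ∧
    ∀ j < m, Circuit.run (carryLadder T P m) x (T (j + 1)) = xor (x (T (j + 1)))
      (Circuit.run (carryLadder T P m) x (T j) && x (P (j + 1))) := by
  have h := (isCarryFamily_logMCX hT hP hTP).run_ladderCircuit (Nat.size m) 0
    (by simpa using Nat.lt_size_self m) x
  have hprod : ∀ j, prodBits (fun i (x : Q → Bool) => x (P i)) x j (j + 1) = x (P (j + 1)) :=
    fun j => by
      rw [prodBits, Nat.Ioc_succ_singleton]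
      simp
  unfold carryLadder
  simpa only [pow_zero, Nat.mul_one, hprod, Nat.succ_le_iff] using h

theorem fits_carryLadder (hT : ∀ i j, i < j → j ≤ m → T i ≠ T j)
    (hP : ∀ i j, 0 < i → i < j → j ≤ m → P i ≠ P j)
    (hTP : ∀ i ≤ m, ∀ j, 0 < j → j ≤ m → T i ≠ P j) :
    Fits (carryLadder T P m) (128 * Nat.size m ^ 2) (64 * (m * Nat.size m)) := by
  refine ((isCarryFamily_logMCX hT hP hTP).fits_ladderCircuit (D := fun ℓ => 60 * ℓ + 4)
    (S := fun ℓ => 32 * 2 ^ ℓ)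
    (fun ℓ j hj => fits_logMCX (distinctWires_block hT hP hTP hj)) (Nat.size m) 0).mono ?_ ?_
  · refine (Finset.sum_le_card_nsmul _ _ (128 * Nat.size m) fun i hi => ?_).trans_eq ?_
    · rw [Finset.mem_range] at hi
      simp only [Nat.zero_add]
      omega
    · rw [Finset.card_range, smul_eq_mul]
      ring
  · refine (Finset.sum_le_card_nsmul _ _ (64 * m) fun i hi => ?_).trans_eq ?_
    · have := Nat.div_mul_le_self m (2 ^ i)
      simp only [Nat.zero_add]
      calc 2 * (m / 2 ^ i * (32 * 2 ^ i)) = 64 * (m / 2 ^ i * 2 ^ i) := by ring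
        _ ≤ 64 * m := by omega
    · rw [Finset.card_range, smul_eq_mul]
      ring

end CarryLadder

/-! ### Operators that permute the computational basis -/

section Operators

variable {Q : Type} [Fintype Q] [DecidableEq Q]

@[simp] theorem linearExt_ket (v : (Q → Bool) → QState Q) (x : Q → Bool) :
    linearExt v (ket x) = v x := by
  have h : ket x = (EuclideanSpace.basisFun (Q → Bool) ℂ).toBasis x := by
    simp [ket]
  rw [linearExt, h, Module.Basis.constr_basis]

@[simp] theorem basisOp_ket (f : (Q → Bool) → Q → Bool) (x : Q → Bool) :
    basisOp f (ket x) = ket (f x) := by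
  simp [basisOp]

theorem qop_ext {U V : QOp Q} (h : ∀ x, U (ket x) = V (ket x)) : U = V := by
  refine (EuclideanSpace.basisFun (Q → Bool) ℂ).toBasis.ext fun x => ?_
  simpa [ket] using h x

theorem basisOp_comp (f g : (Q → Bool) → Q → Bool) :
    basisOp g ∘ₗ basisOp f = basisOp fun x => g (f x) :=
  qop_ext fun x => by simp

theorem inner_ket (x y : Q → Bool) : inner ℂ (ket x) (ket y) = if x = y then (1 : ℂ) else 0 := by
  simp [ket, EuclideanSpace.inner_single_left]

theorem adjoint_basisOp {f g : (Q → Bool) → Q → Bool} (hgf : ∀ x, g (f x) = x)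
    (hfg : ∀ x, f (g x) = x) : LinearMap.adjoint (basisOp f) = basisOp g := by
  refine Eq.symm ((LinearMap.eq_adjoint_iff_basis
    (EuclideanSpace.basisFun (Q → Bool) ℂ).toBasis
    (EuclideanSpace.basisFun (Q → Bool) ℂ).toBasis _ _).2 fun x y => ?_)
  have h : ∀ x, (EuclideanSpace.basisFun (Q → Bool) ℂ).toBasis x = ket x := fun x => by simp [ket]
  rw [h, h, basisOp_ket, basisOp_ket, inner_ket, inner_ket]
  congr 1
  rw [eq_iff_iff]
  constructor
  · rintro rfl
    exact (hfg x).symm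
  · rintro rfl
    exact hgf y

/-- The map `f` on the bits of the qubits `w`, the other bits being kept. -/
noncomputable def liftMap {Q : Type} {m : ℕ} (w : Fin m ↪ Q)
    (f : (Fin m → Bool) → Fin m → Bool) (x : Q → Bool) : Q → Bool :=
  Function.extend w (f (x ∘ w)) x

omit [Fintype Q] [DecidableEq Q] in
theorem liftMap_eq_iff {m : ℕ} {w : Fin m ↪ Q} {f : (Fin m → Bool) → Fin m → Bool}
    {x y : Q → Bool} :
    liftMap w f x = y ↔ (∀ i, y (w i) = f (x ∘ w) i) ∧ ∀ q, (∀ i, q ≠ w i) → y q = x q := by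
  constructor
  · rintro rfl
    refine ⟨fun i => w.injective.extend_apply _ _ i, fun q hq => Function.extend_apply' _ _ _ ?_⟩
    rintro ⟨i, hi⟩
    exact hq i hi.symm
  · rintro ⟨h1, h2⟩
    funext q
    by_cases hq : ∃ i, w i = q
    · obtain ⟨i, rfl⟩ := hq
      rw [liftMap, w.injective.extend_apply, h1]
    · rw [liftMap, Function.extend_apply' _ _ _ hq, h2]
      exact fun i hi => hq ⟨i, hi.symm⟩

theorem applyOn_basisOp {m : ℕ} (w : Fin m ↪ Q) (f : (Fin m → Bool) → Fin m → Bool) :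
    applyOn w (basisOp f) = basisOp (liftMap w f) := by
  refine qop_ext fun x => ?_
  rw [applyOn, linearExt_ket, basisOp_ket, basisOp_ket, Finset.sum_eq_single (f (x ∘ w))]
  · simp [ket, liftMap]
  · intro y _ hy
    simp [ket, hy]
  · simp

theorem applyOn_adjoint_basisOp {m : ℕ} (w : Fin m ↪ Q) {f : (Fin m → Bool) → Fin m → Bool}
    (hf : Function.Injective f) {g : (Q → Bool) → Q → Bool} (hg : ∀ x, liftMap w f (g x) = x) :
    applyOn w (LinearMap.adjoint (basisOp f)) = basisOp g := by
  have hs : Function.Surjective f := Finite.surjective_of_injective hf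
  obtain ⟨f', hff'⟩ := hs.hasRightInverse
  rw [adjoint_basisOp (fun x => hf (hff' (f x))) hff', applyOn_basisOp]
  congr 1
  funext x
  rw [liftMap_eq_iff]
  obtain ⟨h1, h2⟩ := liftMap_eq_iff.1 (hg x)
  constructor
  · intro i
    have : x ∘ w = f (g x ∘ w) := funext h1
    rw [this, hf (hff' (f (g x ∘ w)))]
    rfl
  · exact fun q hq => (h2 q hq).symm

/-! ### Operators of circuits and of programs -/

theorem liftMap_cnot {Q : Type} [DecidableEq Q] (w : Fin 2 ↪ Q) (x : Q → Bool) :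
    liftMap w (fun x i => if i = Fin.last 1 then
      xor (x i) (decide (∀ j : Fin 1, x j.castSucc = true)) else x i) x = (Gate.cnot w).act x := by
  rw [liftMap_eq_iff]
  constructor
  · intro i
    fin_cases i <;> simp [Gate.act, Fin.last]
  · intro q hq
    simp [Gate.act, hq 1]

theorem liftMap_toffoli {Q : Type} [DecidableEq Q] (w : Fin 3 ↪ Q) (x : Q → Bool) :
    liftMap w (fun x i => if i = Fin.last 2 then
      xor (x i) (decide (∀ j : Fin 2, x j.castSucc = true)) else x i) x =
      (Gate.toffoli w).act x := by
  rw [liftMap_eq_iff]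
  constructor
  · intro i
    fin_cases i <;> simp [Gate.act, Fin.last, Fin.forall_fin_two]
  · intro q hq
    simp [Gate.act, hq 2]

theorem Gate.toOp_toInstruction (g : Gate Q) : g.toInstruction.toOp = basisOp g.act := by
  cases g with
  | cnot w =>
    refine (applyOn_basisOp w _).trans ?_
    exact congrArg basisOp (funext (liftMap_cnot w))
  | toffoli w =>
    refine (applyOn_basisOp w _).trans ?_
    exact congrArg basisOp (funext (liftMap_toffoli w))

theorem Circuit.toOp_eq_basisOp (G : Circuit Q) : Circuit.toOp G = basisOp (Circuit.run G) := by
  induction G with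
  | nil => exact qop_ext fun x => by simp [Circuit.toOp, programOp]
  | cons g G ih =>
    refine (congrArg₂ (· ∘ₗ ·) ih g.toOp_toInstruction).trans ?_
    exact basisOp_comp _ _

theorem programOp_append (l l' : List (Instruction Q)) :
    programOp (l ++ l') = programOp l' ∘ₗ programOp l := by
  induction l with
  | nil => rfl
  | cons s l ih => rw [List.cons_append, programOp, ih, LinearMap.comp_assoc, ← programOp]

theorem toOp_flatten {l : List (Instruction Q)} {parts : List (Circuit Q)}
    (h : List.Forall₂ (fun s G => Circuit.toOp G = s.toOp) l parts) :
    Circuit.toOp parts.flatten = programOp l := by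
  induction h with
  | nil => rfl
  | cons hsG _ ih =>
    rw [programOp, ← ih, ← hsG, List.flatten_cons, Circuit.toOp, List.map_append,
      programOp_append]
    rfl

theorem toOp_of_run {m : ℕ} {w : Fin m ↪ Q} {f : (Fin m → Bool) → Fin m → Bool} {G : Circuit Q}
    (h : ∀ x, liftMap w f x = Circuit.run G x) :
    Circuit.toOp G = applyOn w (basisOp f) := by
  rw [applyOn_basisOp, Circuit.toOp_eq_basisOp]
  exact congrArg basisOp (funext fun x => (h x).symm)

omit [Fintype Q] in
theorem injective_of_run {m : ℕ} {w : Fin m ↪ Q} {f : (Fin m → Bool) → Fin m → Bool}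
    {G : Circuit Q} (h : ∀ x, liftMap w f x = Circuit.run G x) : Function.Injective f := by
  intro u v huv
  have hw : ∀ u : Fin m → Bool, Function.extend w u (fun _ => false) ∘ w = u := fun u =>
    funext fun i => w.injective.extend_apply _ _ i
  have hl : liftMap w f (Function.extend w u fun _ => false) =
      liftMap w f (Function.extend w v fun _ => false) := by
    rw [liftMap_eq_iff]
    obtain ⟨h1, h2⟩ := liftMap_eq_iff.1 (rfl : liftMap w f (Function.extend w v fun _ => false) = _)
    refine ⟨fun i => by rw [h1, hw, hw, huv], fun q hq => ?_⟩
    have hq' : ¬ ∃ i, w i = q := fun ⟨i, hi⟩ => hq i hi.symm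
    rw [h2 q hq, Function.extend_apply' _ _ _ hq', Function.extend_apply' _ _ _ hq']
  rw [h, h] at hl
  have := congrArg (Circuit.run G.reverse) hl
  rw [Circuit.run_reverse_run, Circuit.run_reverse_run] at this
  rw [← hw u, this, hw v]

theorem toOp_reverse_of_run {m : ℕ} {w : Fin m ↪ Q} {f : (Fin m → Bool) → Fin m → Bool}
    {G : Circuit Q} (h : ∀ x, liftMap w f x = Circuit.run G x) :
    Circuit.toOp G.reverse = applyOn w (LinearMap.adjoint (basisOp f)) := by
  rw [applyOn_adjoint_basisOp w (injective_of_run h) (g := Circuit.run G.reverse)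
    fun x => by rw [h, Circuit.run_run_reverse], Circuit.toOp_eq_basisOp]

end Operators

/-! ### Circuits for the ladders, the fan-out operators and `MCX 3` -/

section Instructions

variable {Q : Type} [DecidableEq Q]

/-- The bit map of `ladder1 m`. -/
def ladder1Map (m : ℕ) (x : Fin (m + 1) → Bool) (i : Fin (m + 1)) : Bool :=
  Fin.cases (x 0) (fun j : Fin m => xor (x j.succ) (x j.castSucc)) i

/-- The bit map of `ladder2 m`. -/
def ladder2Map (m : ℕ) (x : Fin (2 * m + 1) → Bool) (i : Fin (2 * m + 1)) : Bool :=
  if 2 ≤ i.val ∧ i.val % 2 = 0 then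
    xor (x i) (x ⟨i.val - 2, by omega⟩ && x ⟨i.val - 1, by omega⟩)
  else x i

/-- The bit map of `fanOut1 m`. -/
def fanOut1Map (m : ℕ) (x : Fin (m + 1) → Bool) (i : Fin (m + 1)) : Bool :=
  Fin.cases (x 0) (fun j : Fin m => xor (x j.succ) (x 0)) i

/-- The bit map of `fanOut2 m`. -/
def fanOut2Map (m : ℕ) (x : Fin (2 * m + 1) → Bool) (i : Fin (2 * m + 1)) : Bool :=
  if 2 ≤ i.val ∧ i.val % 2 = 0 then xor (x i) (x 0 && x ⟨i.val - 1, by omega⟩) else x i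

/-- The bit map of `MCX k`. -/
def mcxMap (k : ℕ) (x : Fin (k + 1) → Bool) (i : Fin (k + 1)) : Bool :=
  if i = Fin.last k then xor (x i) (decide (∀ j : Fin k, x j.castSucc = true)) else x i

/-- The qubits `w i`, with indices `i : ℕ` that are reduced modulo `m + 1`. -/
def wireNat {m : ℕ} (w : Fin (m + 1) ↪ Q) (i : ℕ) : Q := w (Fin.ofNat (m + 1) i)

omit [DecidableEq Q] in
theorem wireNat_eq {m : ℕ} (w : Fin (m + 1) ↪ Q) {i : ℕ} (hi : i < m + 1) :
    wireNat w i = w ⟨i, hi⟩ := by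
  rw [wireNat]
  congr 1
  exact Fin.ext (Nat.mod_eq_of_lt hi)

omit [DecidableEq Q] in
theorem wireNat_val {m : ℕ} (w : Fin (m + 1) ↪ Q) (i : Fin (m + 1)) :
    wireNat w i = w i :=
  wireNat_eq w i.isLt

omit [DecidableEq Q] in
theorem wireNat_ne {m : ℕ} (w : Fin (m + 1) ↪ Q) {i j : ℕ} (hi : i < m + 1) (hj : j < m + 1)
    (hij : i ≠ j) : wireNat w i ≠ wireNat w j := by
  rw [wireNat_eq w hi, wireNat_eq w hj]
  intro h
  exact hij (by simpa using w.injective h)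

theorem exists_ladder1_circuit {m : ℕ} (w : Fin (m + 1) ↪ Q) :
    ∃ G : Circuit Q, (∀ x, liftMap w (ladder1Map m) x = Circuit.run G x) ∧
      Fits G (2 * Nat.size m) (4 * m) := by
  have hw : ∀ i j, i < j → j ≤ m → wireNat w i ≠ wireNat w j := fun i j hij hj =>
    wireNat_ne w (by omega) (by omega) hij.ne
  refine ⟨(xorLadder (wireNat w) m).reverse, fun x => ?_, (fits_xorLadder hw).reverse⟩
  obtain ⟨h1, h2⟩ := run_xorLadder hw (Circuit.run (xorLadder (wireNat w) m).reverse x)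
  rw [Circuit.run_run_reverse] at h1 h2
  set y := Circuit.run (xorLadder (wireNat w) m).reverse x
  rw [liftMap_eq_iff]
  constructor
  · intro i
    induction i using Fin.cases with
    | zero =>
      have := h1 (wireNat w 0) fun j hj => hw _ _ (by omega) (by omega)
      rw [wireNat_eq w (by omega)] at this
      exact this.symm
    | succ j =>
      have := h2 j j.isLt
      rw [wireNat_eq w (by omega), wireNat_eq w (by omega)] at this
      change y (w j.succ) = xor (x (w j.succ)) (x (w j.castSucc))
      change x (w j.succ) = xor (y (w j.succ)) (x (w j.castSucc)) at this
      rw [this, Bool.xor_assoc, Bool.xor_self, Bool.xor_false]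
  · exact fun q hq => (h1 q fun j hj => hq _).symm

theorem exists_fanOut1_circuit {m : ℕ} (w : Fin (m + 1) ↪ Q) :
    ∃ G : Circuit Q, (∀ x, liftMap w (fanOut1Map m) x = Circuit.run G x) ∧
      Fits G (4 * Nat.size m + 1) (8 * m) := by
  have hw : ∀ i j, i < j → j < m → wireNat w (i + 1) ≠ wireNat w (j + 1) := fun i j hij hj =>
    wireNat_ne w (by omega) (by omega) (by omega)
  have hc : ∀ i < m, wireNat w 0 ≠ wireNat w (i + 1) := fun i hi =>
    wireNat_ne w (by omega) (by omega) (by omega)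
  refine ⟨fanOutCircuit (wireNat w 0) (fun i => wireNat w (i + 1)) m, fun x => ?_,
    fits_fanOutCircuit hw⟩
  obtain ⟨h1, h2⟩ := run_fanOutCircuit hw hc x
  rw [liftMap_eq_iff]
  constructor
  · intro i
    induction i using Fin.cases with
    | zero =>
      have := h1 _ hc
      rw [wireNat_eq w (by omega)] at this ⊢
      exact this
    | succ j =>
      have := h2 j j.isLt
      rw [wireNat_eq w (by omega), wireNat_eq w (by omega)] at this
      rw [wireNat_eq w (by omega)]
      exact this
  · exact fun q hq => h1 q fun j hj => hq _

theorem exists_ladder2_circuit {m : ℕ} (w : Fin (2 * m + 1) ↪ Q) :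
    ∃ G : Circuit Q, (∀ x, liftMap w (ladder2Map m) x = Circuit.run G x) ∧
      Fits G (128 * Nat.size m ^ 2) (64 * (m * Nat.size m)) := by
  have hne : ∀ i j, i < 2 * m + 1 → j < 2 * m + 1 → i ≠ j → wireNat w i ≠ wireNat w j :=
    fun i j hi hj hij => wireNat_ne w hi hj hij
  have hT : ∀ i j, i < j → j ≤ m → wireNat w (2 * i) ≠ wireNat w (2 * j) := fun i j hij hj =>
    hne _ _ (by omega) (by omega) (by omega)
  have hP : ∀ i j, 0 < i → i < j → j ≤ m → wireNat w (2 * i - 1) ≠ wireNat w (2 * j - 1) :=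
    fun i j hi hij hj => hne _ _ (by omega) (by omega) (by omega)
  have hTP : ∀ i ≤ m, ∀ j, 0 < j → j ≤ m → wireNat w (2 * i) ≠ wireNat w (2 * j - 1) :=
    fun i hi j hj hj' => hne _ _ (by omega) (by omega) (by omega)
  refine ⟨(carryLadder (fun i => wireNat w (2 * i)) (fun i => wireNat w (2 * i - 1)) m).reverse,
    fun x => ?_, (fits_carryLadder hT hP hTP).reverse⟩
  set G := carryLadder (fun i => wireNat w (2 * i)) (fun i => wireNat w (2 * i - 1)) m
  obtain ⟨h1, h2⟩ := run_carryLadder hT hP hTP (Circuit.run G.reverse x)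
  rw [Circuit.run_run_reverse] at h1 h2
  set y := Circuit.run G.reverse x
  rw [liftMap_eq_iff]
  constructor
  · intro i
    unfold ladder2Map
    split_ifs with hi
    · obtain ⟨j, hj⟩ : ∃ j, i.val = 2 * (j + 1) := ⟨i.val / 2 - 1, by omega⟩
      have hjm := i.isLt
      have k1 := h2 j (by omega)
      have k2 : x (wireNat w (2 * (j + 1) - 1)) = y (wireNat w (2 * (j + 1) - 1)) :=
        h1 _ fun l hl => (hTP (l + 1) (by omega) (j + 1) (by omega) (by omega)).symm
      rw [← k2, ← hj, wireNat_val, show 2 * j = i.val - 2 by omega, wireNat_eq w (by omega),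
        wireNat_eq w (by omega)] at k1
      simp only [Function.comp_apply]
      rw [k1, Bool.xor_assoc, Bool.xor_self, Bool.xor_false]
    · have := h1 (w i) fun l hl => by
        have := i.isLt
        rw [← wireNat_val]
        exact hne _ _ (by omega) (by omega) (by omega)
      exact this.symm
  · exact fun q hq => (h1 q fun j hj => hq _).symm

theorem exists_fanOut2_circuit {m : ℕ} (w : Fin (2 * m + 1) ↪ Q) :
    ∃ G : Circuit Q, (∀ x, liftMap w (fanOut2Map m) x = Circuit.run G x) ∧
      Fits G (16 * Nat.size m + 9) (18 * m) := by
  have hne : ∀ i j, i < 2 * m + 1 → j < 2 * m + 1 → i ≠ j → wireNat w i ≠ wireNat w j :=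
    fun i j hi hj hij => wireNat_ne w hi hj hij
  have hu : ∀ i j, i < j → j < m → wireNat w (2 * i + 1) ≠ wireNat w (2 * j + 1) :=
    fun i j hij hj => hne _ _ (by omega) (by omega) (by omega)
  have hv : ∀ i j, i < j → j < m → wireNat w (2 * i + 2) ≠ wireNat w (2 * j + 2) :=
    fun i j hij hj => hne _ _ (by omega) (by omega) (by omega)
  have hcu : ∀ i < m, wireNat w 0 ≠ wireNat w (2 * i + 1) := fun i hi =>
    hne _ _ (by omega) (by omega) (by omega)
  have hcv : ∀ i < m, wireNat w 0 ≠ wireNat w (2 * i + 2) := fun i hi =>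
    hne _ _ (by omega) (by omega) (by omega)
  have huv : ∀ i < m, ∀ j < m, wireNat w (2 * i + 1) ≠ wireNat w (2 * j + 2) :=
    fun i hi j hj => hne _ _ (by omega) (by omega) (by omega)
  refine ⟨fanOut2Circuit (wireNat w 0) (fun i => wireNat w (2 * i + 1))
    (fun i => wireNat w (2 * i + 2)) m, fun x => ?_, fits_fanOut2Circuit hu hv huv⟩
  obtain ⟨h1, h2⟩ := run_fanOut2Circuit hv hcu hcv huv x
  rw [liftMap_eq_iff]
  constructor
  · intro i
    unfold fanOut2Map
    split_ifs with hi
    · obtain ⟨j, hj⟩ : ∃ j, i.val = 2 * j + 2 := ⟨i.val / 2 - 1, by omega⟩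
      have hjm := i.isLt
      have k := h2 j (by omega)
      rw [← hj, wireNat_val, show 2 * j + 1 = i.val - 1 by omega, wireNat_eq w (by omega),
        wireNat_eq w (i := i.val - 1) (by omega)] at k
      exact k
    · exact h1 (w i) fun l hl => by
        have := i.isLt
        rw [← wireNat_val]
        exact hne _ _ (by omega) (by omega) (by omega)
  · exact fun q hq => h1 q fun j hj => hq _

/-- `MCX 3` is implemented with the help of any further qubit `d`. -/
theorem exists_mcx3_circuit (w : Fin 4 ↪ Q) {d : Q} (hd : ∀ i, w i ≠ d) :
    ∃ G : Circuit Q, (∀ x, liftMap w (mcxMap 3) x = Circuit.run G x) ∧ Fits G 4 4 := by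
  refine ⟨mcxDirty 0 (wireNat w) (fun _ => d) (w 3), fun x => ?_, fits_mcxDirty 0 _ _ _⟩
  have hw : ∀ i j : Fin 4, i ≠ j → w i ≠ w j := fun i j hij h => hij (w.injective h)
  rw [run_mcxDirty (wireNat_ne w (by omega) (by omega) (by omega)) (fun i j hij hj => by omega)
    (fun i hi j hj => hd _) (fun i hi => ?_) (fun i hi => (hd 3).symm), liftMap_eq_iff]
  · have hall : (∀ l ≤ 0 + 2, x (wireNat w l) = true) ↔
        ∀ j : Fin 3, (x ∘ w) j.castSucc = true := by
      constructor
      · intro h j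
        have := h j (by omega)
        rwa [wireNat_eq w (by omega)] at this
      · intro h l hl
        rw [wireNat_eq w (by omega)]
        exact h ⟨l, by omega⟩
    constructor
    · intro i
      unfold mcxMap
      split_ifs with hi
      · subst hi
        rw [← decide_eq_decide.2 hall]
        exact Function.update_self _ _ _
      · exact Function.update_of_ne (hw i 3 hi) _ _
    · exact fun q hq => Function.update_of_ne (hq 3) _ _
  · rw [← wireNat_val w 3]
    exact wireNat_ne w (by omega) (by simp) (by simp; omega)

end Instructions

/-! ### Correctness of the controlled adder -/

/-- The carry bits `κ` of the addition of `a` and `b`: they satisfy the majority recurrence, and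
`a + b` has the bits `a_i ⊕ b_i ⊕ κ_i`. -/
theorem exists_carry (n a b : ℕ) : ∃ κ : ℕ → Bool, κ 0 = false ∧
    (∀ i < n, κ (i + 1) = Bool.atLeastTwo (a.testBit i) (b.testBit i) (κ i)) ∧
    ∀ i ≤ n, (a + b).testBit i = xor (a.testBit i) (xor (b.testBit i) (κ i)) := by
  refine ⟨fun i => BitVec.carry i (BitVec.ofNat (n + 1) a) (BitVec.ofNat (n + 1) b) false,
    by simp, fun i hi => ?_, fun i hi => ?_⟩
  · simp only [BitVec.carry_succ, BitVec.getLsbD_ofNat, decide_eq_true (show i < n + 1 by omega),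
      Bool.true_and]
  · have := BitVec.getLsbD_add (show i < n + 1 by omega) (BitVec.ofNat (n + 1) a)
      (BitVec.ofNat (n + 1) b)
    simpa only [← BitVec.ofNat_add, BitVec.getLsbD_ofNat,
      decide_eq_true (show i < n + 1 by omega), Bool.true_and] using this

/-- The bit assignment of the adder with registers `A` and `B` holding the bits `α i`, `β i`. -/
def adderState (n : ℕ) (c : Bool) (α β : ℕ → Bool) (z : Bool) : Qubit n → Bool
  | .C => c
  | .A i => α i
  | .B i => β i
  | .Z => z

theorem adderState_congr {n : ℕ} {c z : Bool} {α α' β β' : ℕ → Bool} (hα : ∀ i < n, α i = α' i)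
    (hβ : ∀ i < n, β i = β' i) : adderState n c α β z = adderState n c α' β' z := by
  funext q
  cases q with
  | C => rfl
  | A i => exact hα i i.isLt
  | B i => exact hβ i i.isLt
  | Z => rfl

theorem Gate.act_cnot_of_eq {n : ℕ} {w : Fin 2 ↪ Qubit n} {x y : Qubit n → Bool}
    (h1 : y (w 1) = xor (x (w 1)) (x (w 0))) (h : ∀ q, q ≠ w 1 → y q = x q) :
    (Gate.cnot w).act x = y := by
  funext q
  by_cases hq : q = w 1
  · subst hq
    simp [Gate.act, h1]
  · simp [Gate.act, hq, h]

theorem Gate.act_toffoli_of_eq {n : ℕ} {w : Fin 3 ↪ Qubit n} {x y : Qubit n → Bool}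
    (h1 : y (w 2) = xor (x (w 2)) (x (w 0) && x (w 1))) (h : ∀ q, q ≠ w 2 → y q = x q) :
    (Gate.toffoli w).act x = y := by
  funext q
  by_cases hq : q = w 2
  · subst hq
    simp [Gate.act, h1]
  · simp [Gate.act, hq, h]

namespace ControlledAdder

section Steps

variable {n : ℕ} {c z : Bool} {α α' β β' : ℕ → Bool}

theorem cnotAB_toOp (i : Fin n) : (cnotAB i).toOp = basisOp (Gate.cnot (cnotAB i).wires).act :=
  Gate.toOp_toInstruction (Gate.cnot (cnotAB i).wires)

theorem cnotAB_ket (i : Fin n) : (cnotAB i).toOp (ket (adderState n c α β z)) =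
    ket (adderState n c α (fun j => if j = i then xor (β j) (α j) else β j) z) := by
  rw [cnotAB_toOp, basisOp_ket]
  congr 1
  refine Gate.act_cnot_of_eq ?_ ?_
  · exact if_pos rfl
  · intro q hq
    cases q with
    | B j =>
      have : (j : ℕ) ≠ i := fun h => hq (congrArg Qubit.B (Fin.ext h))
      exact if_neg this
    | _ => rfl

theorem cnotLoop_ket (hβ : ∀ i < n, β' i = if i = 0 then β i else xor (β i) (α i)) :
    programOp (cnotLoop n) (ket (adderState n c α β z)) = ket (adderState n c α β' z) := by
  have key : ∀ (l : List (Fin (n - 1))) (β : ℕ → Bool), l.Nodup →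
      programOp (l.map fun i => cnotAB ⟨i.val + 1, by omega⟩) (ket (adderState n c α β z)) =
        ket (adderState n c α
          (fun j => if ∃ i ∈ l, j = i.val + 1 then xor (β j) (α j) else β j) z) := by
    intro l
    induction l with
    | nil => intro β _; simp [programOp]
    | cons i l ih =>
      intro β hl
      rw [List.nodup_cons] at hl
      rw [List.map_cons, programOp, LinearMap.comp_apply, cnotAB_ket, ih _ hl.2]
      congr 1
      refine adderState_congr (fun _ _ => rfl) fun j _ => ?_
      by_cases hj : j = i.val + 1
      · have hnot : ¬ ∃ k ∈ l, j = k.val + 1 := by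
          rintro ⟨k, hk, hjk⟩
          have : k = i := Fin.ext (by omega)
          exact hl.1 (this ▸ hk)
        simp [hj] at hnot ⊢
        intro k hk hik
        exact absurd hik (hnot k hk)
      · simp [hj]
  rw [cnotLoop, key _ _ (List.nodup_finRange _)]
  congr 1
  refine adderState_congr (fun _ _ => rfl) fun j hj => ?_
  rw [hβ j hj]
  rcases Nat.eq_zero_or_pos j with rfl | h
  · simp
  · rw [if_pos ⟨⟨j - 1, by omega⟩, List.mem_finRange _, by simp; omega⟩, if_neg (by omega)]

theorem toffoliCAZ_ket (hn : 2 ≤ n) :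
    (toffoliCAZ n hn).toOp (ket (adderState n c α β z)) =
      ket (adderState n c α β (xor z (c && α (n - 1)))) := by
  have h : (toffoliCAZ n hn).toOp = basisOp (Gate.toffoli (toffoliCAZ n hn).wires).act :=
    Gate.toOp_toInstruction (Gate.toffoli (toffoliCAZ n hn).wires)
  rw [h, basisOp_ket]
  congr 1
  refine Gate.act_toffoli_of_eq ?_ ?_
  · rfl
  · intro q hq
    cases q with
    | Z => exact absurd rfl hq
    | _ => rfl

theorem toffoliCAB_ket (hn : 2 ≤ n)
    (hβ : ∀ i < n, β' i = if i = 0 then xor (β i) (c && α i) else β i) :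
    (toffoliCAB n hn).toOp (ket (adderState n c α β z)) = ket (adderState n c α β' z) := by
  have h : (toffoliCAB n hn).toOp = basisOp (Gate.toffoli (toffoliCAB n hn).wires).act :=
    Gate.toOp_toInstruction (Gate.toffoli (toffoliCAB n hn).wires)
  rw [h, basisOp_ket]
  congr 1
  refine Gate.act_toffoli_of_eq ?_ ?_
  · exact hβ 0 (by omega)
  · intro q hq
    cases q with
    | B i =>
      have hi : (i : ℕ) ≠ 0 := fun h => hq (congrArg Qubit.B (Fin.ext h))
      have := hβ i i.isLt
      rwa [if_neg hi] at this
    | _ => rfl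

theorem toOp_ket_of_liftMap {m : ℕ} {w : Fin m ↪ Qubit n} {f : (Fin m → Bool) → Fin m → Bool}
    {x y : Qubit n → Bool} (h : liftMap w f x = y) :
    Instruction.toOp ⟨_, w, basisOp f⟩ (ket x) = ket y := by
  rw [Instruction.toOp, applyOn_basisOp, basisOp_ket, h]

/-- The adjoint of a permutation of the basis states is its inverse; the circuit `G` only serves
to show that `f` is invertible. -/
theorem toOp_adjoint_ket_of_liftMap {m : ℕ} {w : Fin m ↪ Qubit n}
    {f : (Fin m → Bool) → Fin m → Bool} {G : Circuit (Qubit n)}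
    (hG : ∀ x, liftMap w f x = Circuit.run G x)
    {x y : Qubit n → Bool} (h : liftMap w f y = x) :
    Instruction.toOp ⟨_, w, LinearMap.adjoint (basisOp f)⟩ (ket x) = ket y := by
  rw [Instruction.toOp, ← toOp_reverse_of_run hG, Circuit.toOp_eq_basisOp, basisOp_ket, ← h, hG,
    Circuit.run_reverse_run]

theorem mcxCABZ_ket (hn : 2 ≤ n) :
    (mcxCABZ n hn).toOp (ket (adderState n c α β z)) =
      ket (adderState n c α β (xor z (c && (α (n - 1) && β (n - 1))))) := by
  refine toOp_ket_of_liftMap (f := mcxMap 3) (liftMap_eq_iff.2 ⟨fun i => ?_, fun q hq => ?_⟩)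
  · fin_cases i
    · rfl
    · rfl
    · rfl
    · change xor z (c && (α (n - 1) && β (n - 1))) = xor z (decide _)
      congr 1
      rw [Bool.eq_iff_iff, decide_eq_true_iff]
      simp only [Fin.forall_fin_succ, Bool.and_eq_true]
      exact ⟨fun h => ⟨h.1, h.2.1, h.2.2, fun i => i.elim0⟩, fun h => ⟨h.1, h.2.1, h.2.2.1⟩⟩
  · cases q with
    | Z => exact absurd rfl (hq 3)
    | _ => rfl

theorem liftMap_ladder1 (hn : 2 ≤ n)
    (hα : ∀ i < n, α' i = if 2 ≤ i then xor (α i) (α (i - 1)) else α i) :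
    liftMap (wiresA n hn) (ladder1Map (n - 2)) (adderState n c α β z) =
      adderState n c α' β z := by
  rw [liftMap_eq_iff]
  constructor
  · intro i
    induction i using Fin.cases with
    | zero =>
      have := hα 1 (by omega)
      rwa [if_neg (by omega)] at this
    | succ j =>
      have := hα (j + 1 + 1) (by omega)
      rwa [if_pos (by omega)] at this
  · intro q hq
    cases q with
    | A i =>
      rcases Nat.eq_zero_or_pos i with h | h
      · have := hα i i.isLt
        rwa [if_neg (by omega)] at this
      · refine absurd ?_ (hq ⟨i - 1, by omega⟩)
        exact congrArg Qubit.A (Fin.ext (by simp only; omega))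
    | _ => rfl

theorem liftMap_ladder2 (hn : 2 ≤ n)
    (hα : ∀ i < n, α' i = if i = 0 then α i else xor (α i) (α (i - 1) && β (i - 1))) :
    liftMap (wiresAB n hn) (ladder2Map (n - 1)) (adderState n c α β z) =
      adderState n c α' β z := by
  have hA : ∀ (j : Fin (2 * (n - 1) + 1)) (k : ℕ) (hk : k < n),
      j.val = 2 * k → wiresAB n hn j = .A ⟨k, hk⟩ := fun j k hk hj =>
    (if_pos (by omega)).trans (congrArg Qubit.A (Fin.ext (by simp only; omega)))
  have hB : ∀ (j : Fin (2 * (n - 1) + 1)) (k : ℕ) (hk : k < n),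
      j.val = 2 * k + 1 → wiresAB n hn j = .B ⟨k, hk⟩ := fun j k hk hj =>
    (if_neg (by omega)).trans (congrArg Qubit.B (Fin.ext (by simp only; omega)))
  rw [liftMap_eq_iff]
  constructor
  · intro i
    have hi := i.isLt
    unfold ladder2Map
    simp only [Function.comp_apply]
    split_ifs with h
    · obtain ⟨k, hk⟩ : ∃ k, i.val = 2 * (k + 1) := ⟨i.val / 2 - 1, by omega⟩
      rw [hA i (k + 1) (by omega) hk, hA ⟨i.val - 2, _⟩ k (by omega) (by simp only; omega),
        hB ⟨i.val - 1, _⟩ k (by omega) (by simp only; omega)]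
      have := hα (k + 1) (by omega)
      rwa [if_neg (by omega)] at this
    · rcases Nat.even_or_odd' i.val with ⟨k, hk | hk⟩
      · obtain rfl : k = 0 := by omega
        rw [hA i 0 (by omega) hk]
        exact hα 0 (by omega)
      · rw [hB i k (by omega) hk]
        rfl
  · intro q hq
    cases q with
    | A i =>
      exact absurd (hA ⟨2 * i, by omega⟩ i i.isLt rfl).symm (hq _)
    | _ => rfl

theorem liftMap_fanOut2 (hn : 2 ≤ n)
    (hβ : ∀ i < n, β' i = if i = 0 then β i else xor (β i) (c && α i)) :
    liftMap (wiresCAB n hn) (fanOut2Map (n - 1)) (adderState n c α β z) =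
      adderState n c α β' z := by
  have hA : ∀ (j : Fin (2 * (n - 1) + 1)) (k : ℕ) (hk : k < n),
      j.val + 1 = 2 * k → wiresCAB n hn j = .A ⟨k, hk⟩ := fun j k hk hj =>
    (if_neg (by omega)).trans <| (if_pos (by omega)).trans <|
      congrArg Qubit.A (Fin.ext (by simp only; omega))
  have hB : ∀ (j : Fin (2 * (n - 1) + 1)) (k : ℕ) (hk : k < n),
      0 < k → j.val = 2 * k → wiresCAB n hn j = .B ⟨k, hk⟩ := fun j k hk hk' hj =>
    (if_neg (by omega)).trans <| (if_neg (by omega)).trans <|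
      congrArg Qubit.B (Fin.ext (by simp only; omega))
  rw [liftMap_eq_iff]
  constructor
  · intro i
    have hi := i.isLt
    unfold fanOut2Map
    simp only [Function.comp_apply]
    split_ifs with h
    · obtain ⟨k, hk⟩ : ∃ k, i.val = 2 * (k + 1) := ⟨i.val / 2 - 1, by omega⟩
      rw [hB i (k + 1) (by omega) (by omega) hk,
        hA ⟨i.val - 1, _⟩ (k + 1) (by omega) (by simp only; omega)]
      have := hβ (k + 1) (by omega)
      rwa [if_neg (by omega)] at this
    · rcases Nat.even_or_odd' i.val with ⟨k, hk | hk⟩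
      · obtain rfl : i = 0 := Fin.ext (by rw [Fin.val_zero]; omega)
        rfl
      · rw [hA i (k + 1) (by omega) (by omega)]
        rfl
  · intro q hq
    cases q with
    | B i =>
      rcases Nat.eq_zero_or_pos i with h | h
      · have := hβ i i.isLt
        rwa [if_pos h] at this
      · exact absurd (hB ⟨2 * i, by omega⟩ i i.isLt h rfl).symm (hq _)
    | _ => rfl

theorem liftMap_fanOut1 (hn : 2 ≤ n)
    (hβ : ∀ i < n, β' i = if i = 0 ∨ i = n - 1 then β i else xor (β i) c) :
    liftMap (wiresCB n hn) (fanOut1Map (n - 2)) (adderState n c α β z) =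
      adderState n c α β' z := by
  rw [liftMap_eq_iff]
  constructor
  · intro i
    induction i using Fin.cases with
    | zero => rfl
    | succ j =>
      have := hβ (j + 1) (by omega)
      rwa [if_neg (by omega)] at this
  · intro q hq
    cases q with
    | B i =>
      by_cases h : i.val = 0 ∨ i.val = n - 1
      · have := hβ i i.isLt
        rwa [if_pos h] at this
      · have h0 : ¬ i.val = 0 := fun h0 => h (Or.inl h0)
        have h1 : i.val < n - 2 + 1 := by omega
        exact absurd (if_neg h0).symm (hq ⟨i, h1⟩)
    | _ => rfl

end Steps

/-- The adder circuit adds. With `κ` the carries, `L₂†` turns the register `A` into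
`a_i ⊕ κ_i`. Then `F₂` adds `c (a_i ⊕ κ_i)` to `B_i = a_i ⊕ b_i`, and the last CNOTs add `a_i`. -/
theorem programOp_controlledAdder (n : ℕ) (hn : 2 ≤ n) (c z : Bool) (a b : ℕ) (ha : a < 2 ^ n)
    (hb : b < 2 ^ n) :
    programOp (controlledAdder n hn) (ket (registerBits n c a b z)) =
      ket (registerBits n c a ((c.toNat * a + b) % 2 ^ n)
        (xor z (c && (a + b).testBit n))) := by
  obtain ⟨κ, hκ0, hκ, hsum⟩ := exists_carry n a b
  set α := a.testBit
  set β := b.testBit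
  obtain ⟨G1, hG1, -⟩ := exists_ladder1_circuit (wiresA n hn)
  obtain ⟨G2, hG2, -⟩ := exists_ladder2_circuit (wiresAB n hn)
  have hstart : registerBits n c a b z = adderState n c α β z := by
    funext q; cases q <;> rfl
  -- The successive contents of the registers: `β₁` after the first CNOTs, `α₁` after `L₁`, `α₂`
  -- after `L₂†`, `β₂` after `F₂`, `β₃` between the two `F₁`, `β₄` after the last Toffoli gate,
  -- and `β₅` at the end.
  let β₁ : ℕ → Bool := fun i => if i = 0 then β i else xor (β i) (α i)
  let α₁ : ℕ → Bool := fun i => if 2 ≤ i then xor (α i) (α (i - 1)) else α i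
  let α₂ : ℕ → Bool := fun i => xor (α i) (κ i)
  let β₂ : ℕ → Bool := fun i => if i = 0 then β i else xor (β₁ i) (c && α₂ i)
  let β₃ : ℕ → Bool := fun i => if i = 0 ∨ i = n - 1 then β₂ i else xor (β₂ i) c
  let β₄ : ℕ → Bool := fun i => if i = 0 then xor (β i) (c && α i) else β₂ i
  let β₅ : ℕ → Bool := fun i => if i = 0 then β₄ i else xor (β₄ i) (α i)
  have hκ' : ∀ i, i + 1 < n → κ (i + 1) =
      Bool.atLeastTwo (α i) (β i) (κ i) := fun i hi => hκ i (by omega)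
  -- `L₂` maps `α₂` to `α₁`: this is the carry recurrence `κ' = a ⊕ (a ⊕ κ) (a ⊕ b)`.
  have e1 : ∀ i < n, α₁ i = if i = 0 then α₂ i else xor (α₂ i) (α₂ (i - 1) && β₁ (i - 1)) := by
    intro i hi
    match i with
    | 0 => simp [α₁, α₂, hκ0]
    | 1 =>
      simp only [α₁, α₂, β₁, hκ' 0 hi, hκ0, Bool.atLeastTwo]
      cases α 0 <;> cases β 0 <;> simp
    | i + 2 =>
      simp only [α₁, α₂, β₁, hκ' (i + 1) hi, Bool.atLeastTwo]
      simp
      cases α (i + 1) <;> cases β (i + 1) <;> cases κ (i + 1) <;> simp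
  -- The modified register `B` uncomputes the carries just as well: if `c = 1`, it holds
  -- `b ⊕ κ ⊕ 1` instead of `a ⊕ b`, and the two agree wherever the factor `a ⊕ κ` is `1`.
  have e2 : ∀ i < n, α₁ i = if i = 0 then α₂ i else xor (α₂ i) (α₂ (i - 1) && β₃ (i - 1)) := by
    intro i hi
    rw [e1 i hi]
    match i with
    | 0 => rfl
    | 1 => simp [β₁, β₃, β₂]
    | i + 2 =>
      simp [α₂, β₁, β₃, β₂, show i + 1 ≠ n - 1 by omega]
      cases c <;> cases α (i + 1) <;> cases β (i + 1) <;> cases κ (i + 1) <;> simp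
  have e3 : ∀ i < n, β₂ i = if i = 0 ∨ i = n - 1 then β₃ i else xor (β₃ i) c := by
    intro i hi
    by_cases h : i = 0 ∨ i = n - 1
    · simp only [β₃, if_pos h]
    · simp only [β₃, if_neg h, Bool.xor_assoc, Bool.xor_self, Bool.xor_false]
  -- The outgoing carry is the recurrence once more, applied to the most significant bits.
  have hz : xor (xor z (c && α (n - 1))) (c && (α₂ (n - 1) && β₁ (n - 1))) =
      xor z (c && (a + b).testBit n) := by
    have hn1 := hκ (n - 1) (by omega)
    rw [Nat.sub_add_cancel (by omega)] at hn1
    have hc : (a + b).testBit n = κ n := by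
      rw [hsum n le_rfl]
      simp [α, β, Nat.testBit_lt_two_pow ha, Nat.testBit_lt_two_pow hb]
    rw [hc, hn1]
    simp only [α₂, β₁, if_neg (show n - 1 ≠ 0 by omega), Bool.atLeastTwo]
    cases z <;> cases c <;> cases α (n - 1) <;> cases β (n - 1) <;>
      cases κ (n - 1) <;> rfl
  have hend : registerBits n c a ((c.toNat * a + b) % 2 ^ n) (xor z (c && (a + b).testBit n)) =
      adderState n c α β₅ (xor z (c && (a + b).testBit n)) := by
    have hβ₅ : ∀ i < n, ((c.toNat * a + b) % 2 ^ n).testBit i = β₅ i := fun i hi => by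
      rw [Nat.testBit_mod_two_pow, decide_eq_true hi, Bool.true_and]
      cases c with
      | false =>
        by_cases h : i = 0 <;> simp [β₅, β₄, β₂, β₁, h, β]
      | true =>
        simp only [Bool.toNat_true, Nat.one_mul, hsum i hi.le]
        by_cases h : i = 0
        · subst h
          simp [β₅, β₄, hκ0, α, β, Bool.xor_comm]
        · simp only [β₅, β₄, β₂, β₁, α₂, if_neg h]
          cases α i <;> cases β i <;> cases κ i <;> rfl
    funext q
    cases q with
    | B i => exact hβ₅ i i.isLt
    | _ => rfl
  rw [hstart, hend, controlledAdder]
  simp only [programOp_append, programOp, LinearMap.comp_apply, LinearMap.id_apply,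
    show ladder1 (n - 2) = basisOp (ladder1Map (n - 2)) from rfl,
    show ladder2 (n - 1) = basisOp (ladder2Map (n - 1)) from rfl,
    show fanOut1 (n - 2) = basisOp (fanOut1Map (n - 2)) from rfl,
    show fanOut2 (n - 1) = basisOp (fanOut2Map (n - 1)) from rfl]
  rw [cnotLoop_ket (β' := β₁) fun _ _ => rfl, toffoliCAZ_ket,
    toOp_ket_of_liftMap (f := ladder1Map (n - 2)) (liftMap_ladder1 hn (α' := α₁) fun _ _ => rfl),
    toOp_adjoint_ket_of_liftMap hG2 (liftMap_ladder2 hn (α := α₂) e1), mcxCABZ_ket, hz,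
    toOp_ket_of_liftMap (f := fanOut2Map (n - 1)) (liftMap_fanOut2 hn (β' := β₂) fun i _ => ?_),
    toOp_ket_of_liftMap (f := fanOut1Map (n - 2)) (liftMap_fanOut1 hn (β' := β₃) fun _ _ => rfl),
    toOp_ket_of_liftMap (f := ladder2Map (n - 1)) (liftMap_ladder2 hn (α' := α₁) e2),
    toOp_ket_of_liftMap (f := fanOut1Map (n - 2)) (liftMap_fanOut1 hn (β' := β₂) e3),
    toOp_adjoint_ket_of_liftMap hG1 (liftMap_ladder1 hn (α := α) fun _ _ => rfl),
    toffoliCAB_ket hn (β' := β₄) fun i _ => ?_, cnotLoop_ket (β' := β₅) fun _ _ => rfl]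
  · by_cases h : i = 0 <;> simp [β₄, β₂, h]
  · by_cases h : i = 0 <;> simp [β₂, β₁, h]

end ControlledAdder

/-! ### Depth and gate count of the controlled adder -/

section

variable {Q : Type}

/-- Gates on pairwise disjoint sets of qubits fit into one time step. -/
theorem Fits.of_pairwise_disjoint {G : Circuit Q}
    (h : G.Pairwise fun g g' => Disjoint g.support g'.support) : Fits G 1 G.length := by
  refine ⟨le_rfl, G.map fun g => (g, 1), by simp [Function.comp_def], by simp, ?_⟩
  rw [List.pairwise_map]
  exact h.imp fun hd hnd => absurd hd hnd

variable [Fintype Q] [DecidableEq Q]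

/-- The instructions `l` can be implemented, one by one, by circuits that together fit into `d`
time steps and `s` gates. -/
def Realizable (l : List (Instruction Q)) (d s : ℕ) : Prop :=
  ∃ parts : List (Circuit Q), List.Forall₂ (fun s G => Circuit.toOp G = s.toOp) l parts ∧
    Fits parts.flatten d s

theorem Realizable.append {l l' : List (Instruction Q)} {d s d' s' : ℕ} (h : Realizable l d s)
    (h' : Realizable l' d' s') : Realizable (l ++ l') (d + d') (s + s') := by
  obtain ⟨p, hp, hf⟩ := h
  obtain ⟨p', hp', hf'⟩ := h'
  refine ⟨p ++ p', List.rel_append hp hp', ?_⟩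
  rw [List.flatten_append]
  exact hf.append hf'

theorem Realizable.of_circuit {s : Instruction Q} {G : Circuit Q} {d k : ℕ}
    (h : Circuit.toOp G = s.toOp) (hf : Fits G d k) : Realizable [s] d k :=
  ⟨[G], .cons h .nil, by simpa using hf⟩

theorem Realizable.mono {l : List (Instruction Q)} {d s d' s' : ℕ} (h : Realizable l d s)
    (hd : d ≤ d') (hs : s ≤ s') : Realizable l d' s' :=
  h.imp fun _ hp => ⟨hp.1, hp.2.mono hd hs⟩

end

namespace ControlledAdder

theorem realizable_cnotLoop (n : ℕ) : Realizable (cnotLoop n) 1 (n - 1) := by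
  let g : Fin (n - 1) → Gate (Qubit n) := fun i => .cnot (cnotAB ⟨i.val + 1, by omega⟩).wires
  refine ⟨(List.finRange (n - 1)).map fun i => [g i], ?_, ?_⟩
  · rw [cnotLoop, List.forall₂_map_left_iff, List.forall₂_map_right_iff, List.forall₂_same]
    intro i _
    exact (LinearMap.id_comp _ : Circuit.toOp [g i] = _)
  · have hflat : ((List.finRange (n - 1)).map fun i => [g i]).flatten =
        (List.finRange (n - 1)).map g := by
      rw [← List.flatMap_def, List.map_eq_flatMap]
    have hsupp : ∀ i, ∀ q ∈ (g i).support,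
        q = .A ⟨i.val + 1, by omega⟩ ∨ q = .B ⟨i.val + 1, by omega⟩ := by
      intro i q hq
      obtain ⟨a, -, rfl⟩ := Finset.mem_map.1 hq
      change Fin 2 at a
      fin_cases a
      exacts [Or.inl rfl, Or.inr rfl]
    rw [hflat]
    refine (Fits.of_pairwise_disjoint ?_).mono le_rfl (by simp)
    rw [List.pairwise_map]
    refine (List.nodup_finRange _).imp fun {i j} hij => ?_
    rw [Finset.disjoint_left]
    intro q hi hj
    have hval : i.val ≠ j.val := fun h => hij (Fin.ext h)
    rcases hsupp i q hi with rfl | rfl <;> rcases hsupp j _ hj with h | h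
    · exact hval (by simpa using h)
    · cases h
    · cases h
    · exact hval (by simpa using h)

theorem realizable_toffoli {n : ℕ} (w : Fin 3 ↪ Qubit n) : Realizable [⟨3, w, Toffoli⟩] 1 1 :=
  .of_circuit (G := [.toffoli w]) (LinearMap.id_comp _) (Fits.singleton _)

theorem realizable_mcxCABZ (n : ℕ) (hn : 2 ≤ n) : Realizable [mcxCABZ n hn] 4 4 := by
  -- `A_0` is not involved, since `n - 1 ≠ 0`; it serves as a dirty qubit
  obtain ⟨G, hG, hf⟩ := exists_mcx3_circuit (mcxCABZ n hn).wires (d := .A ⟨0, by omega⟩) (by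
    intro i
    change Fin 4 at i
    fin_cases i
    · rintro ⟨⟩
    · intro h
      have := Fin.val_eq_of_eq (Qubit.A.inj h)
      simp only at this
      omega
    · rintro ⟨⟩
    · rintro ⟨⟩)
  exact .of_circuit (toOp_of_run hG) hf

theorem realizable_controlledAdder (n : ℕ) (hn : 2 ≤ n) :
    Realizable (controlledAdder n hn) (400 * Nat.size n ^ 2) (300 * (n * Nat.size n)) := by
  obtain ⟨G1, h1, f1⟩ := exists_ladder1_circuit (wiresA n hn)
  obtain ⟨G2, h2, f2⟩ := exists_ladder2_circuit (wiresAB n hn)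
  obtain ⟨G3, h3, f3⟩ := exists_fanOut2_circuit (wiresCAB n hn)
  obtain ⟨G4, h4, f4⟩ := exists_fanOut1_circuit (wiresCB n hn)
  have hF1 := Realizable.of_circuit (s := ⟨_, wiresCB n hn, fanOut1 (n - 2)⟩) (toOp_of_run h4) f4
  have hL1 := Realizable.of_circuit (s := ⟨_, wiresA n hn, ladder1 (n - 2)⟩) (toOp_of_run h1) f1
  have hL2 := Realizable.of_circuit (s := ⟨_, wiresAB n hn, ladder2 (n - 1)⟩) (toOp_of_run h2) f2
  have hL1' := Realizable.of_circuit
    (s := ⟨_, wiresA n hn, LinearMap.adjoint (ladder1 (n - 2))⟩)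
    (toOp_reverse_of_run h1) f1.reverse
  have hL2' := Realizable.of_circuit
    (s := ⟨_, wiresAB n hn, LinearMap.adjoint (ladder2 (n - 1))⟩)
    (toOp_reverse_of_run h2) f2.reverse
  have hF2 := Realizable.of_circuit (s := ⟨_, wiresCAB n hn, fanOut2 (n - 1)⟩) (toOp_of_run h3) f3
  have hloop := realizable_cnotLoop n
  have hT := realizable_toffoli (toffoliCAZ n hn).wires
  have hT' := realizable_toffoli (toffoliCAB n hn).wires
  have hM := realizable_mcxCABZ n hn
  have htotal := ((((((hloop.append (hT.append hL1)).append (hL2'.append hM)).append hF2).append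
    (hF1.append (hL2.append hF1))).append hL1').append hT').append hloop
  refine Realizable.mono (l := controlledAdder n hn) htotal ?_ ?_
  all_goals
    have hs1 : Nat.size (n - 1) ≤ Nat.size n := Nat.size_le_size (by omega)
    have hs2 : Nat.size (n - 2) ≤ Nat.size n := Nat.size_le_size (by omega)
    have hs : 2 ≤ Nat.size n := Nat.lt_size.2 (by omega)
  · have : Nat.size (n - 1) ^ 2 ≤ Nat.size n ^ 2 := Nat.pow_le_pow_left hs1 2
    nlinarith
  · have h1 : (n - 1) * Nat.size (n - 1) ≤ n * Nat.size n := Nat.mul_le_mul (by omega) hs1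
    have h2 : n * 2 ≤ n * Nat.size n := Nat.mul_le_mul le_rfl hs
    omega

end ControlledAdder

/-- For `n ≥ 2` the binary length of `n` is at most `log₂ n + 1 ≤ 2 log₂ n`. -/
theorem natSize_le_two_mul_logb {n : ℕ} (hn : 2 ≤ n) :
    (Nat.size n : ℝ) ≤ 2 * Real.logb 2 n := by
  obtain ⟨k, hk⟩ : ∃ k, Nat.size n = k + 1 :=
    ⟨Nat.size n - 1, by have := Nat.lt_size.2 (show 2 ^ 0 ≤ n by omega); omega⟩
  have hpow : 2 ^ k ≤ n := Nat.lt_size.1 (by omega)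
  have h1 : (k : ℝ) ≤ Real.logb 2 n := by
    rw [Real.le_logb_iff_rpow_le (by norm_num) (by positivity), Real.rpow_natCast]
    exact_mod_cast hpow
  have h2 : (1 : ℝ) ≤ Real.logb 2 n := by
    rw [Real.le_logb_iff_rpow_le (by norm_num) (by positivity), Real.rpow_one]
    exact_mod_cast hn
  rw [hk]
  push_cast
  linarith

/-- The controlled adder acts as
`|c⟩|a⟩|b⟩|z⟩ ↦ |c⟩|a⟩|c a + b mod 2^n⟩|z ⊕ c (a + b)_n⟩`, and, replacing each of its
instructions by a {Toffoli, CNOT} circuit on the same `2n + 2` qubits that implements that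
instruction, one gets a circuit of depth `O(log² n)` with `O(n log n)` gates. -/
theorem mainTheorem2 :
    (∀ (n : ℕ) (hn : 2 ≤ n) (c z : Bool) (a b : ℕ), a < 2 ^ n → b < 2 ^ n →
      programOp (controlledAdder n hn) (ket (registerBits n c a b z)) =
        ket (registerBits n c a ((c.toNat * a + b) % 2 ^ n)
          (xor z (c && (a + b).testBit n)))) ∧
    ∃ K : ℝ, ∀ (n : ℕ) (hn : 2 ≤ n), ∃ parts : List (Circuit (Qubit n)),
      List.Forall₂ (fun (s : Instruction (Qubit n)) (G : Circuit (Qubit n)) => G.toOp = s.toOp)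
        (controlledAdder n hn) parts ∧
      Circuit.toOp parts.flatten = programOp (controlledAdder n hn) ∧
      (Circuit.depth parts.flatten : ℝ) ≤ K * Real.logb 2 n ^ 2 ∧
      (parts.flatten.length : ℝ) ≤ K * (n * Real.logb 2 n) := by
  refine ⟨ControlledAdder.programOp_controlledAdder, 1600, fun n hn => ?_⟩
  obtain ⟨parts, hparts, hfits⟩ := ControlledAdder.realizable_controlledAdder n hn
  have hsize := natSize_le_two_mul_logb hn
  refine ⟨parts, hparts, toOp_flatten hparts, ?_, ?_⟩
  · calc (Circuit.depth parts.flatten : ℝ) ≤ 400 * (Nat.size n : ℝ) ^ 2 := by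
          exact_mod_cast hfits.depth_le
      _ ≤ 400 * (2 * Real.logb 2 n) ^ 2 := by gcongr
      _ = 1600 * Real.logb 2 n ^ 2 := by ring
  · calc (parts.flatten.length : ℝ) ≤ 300 * (n * (Nat.size n : ℝ)) := by
          exact_mod_cast hfits.1
      _ ≤ 300 * (n * (2 * Real.logb 2 n)) := by gcongr
      _ = 600 * (n * Real.logb 2 n) := by ring
      _ ≤ 1600 * (n * Real.logb 2 n) := by
          have : 0 ≤ (n : ℝ) * Real.logb 2 n :=
            mul_nonneg n.cast_nonneg (by have : (0 : ℝ) ≤ Nat.size n := by positivity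
                                         linarith)
          linarith
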